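/- Let $\Omega\subset\mathbb{R}^2$ be a domain (open and connected) with $B(0,r_0)\subset\Omega$ for some $r_0>0$, let $k\in\mathbb{R}$, and for $j=1,2$ let $\alpha_j,\beta_j,\tilde\beta_j,\theta_j:(-r_0,r_0)\to\mathbb{R}$ be $C^1$ functions. Assume the following non-degeneracy for each $j$: if $\beta_j(0)=\tilde\beta_j(0)=0$, then $\alpha_j(0)\neq 0$ and $\beta_j(r)=o(r)$, $\tilde\beta_j(r)=o(r)$ as $r\to 0$. Put $\varphi_j=0$ if $\beta_j(0)=\tilde\beta_j(0)=0$ and $\varphi_j=\arg\bigl(\beta_j(0)+i\tilde\beta_j(0)\bigr)$ otherwise, and assume that $$\varphi_1-\varphi_2\notin\bigl\{\,n\bigl(\theta_1(0)-\theta_2(0)\bigr)+m\pi:\ n\in\mathbb{Z}\setminus\{0\},\ m\in\mathbb{Z}\,\bigr\}.$$ Let $\gamma_j(r)=(r\cos\theta_j(r),\,r\sin\theta_j(r))$ and $\Gamma_j=\{\gamma_j(r):\ r\in(-r_0,r_0)\}$. For a $C^1$ function $u$ write $\partial_t u(\gamma_j(r))$ for the derivative of $u$ at $\gamma_j(r)$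 in the direction $\gamma_j'(r)$, and $\partial_n u(\gamma_j(r))$ for its derivative in the direction obtained by rotating $\gamma_j'(r)$ counterclockwise by $\pi/2$. In polar coordinates, with $u_p(r,\theta)=u(r\cos\theta,r\sin\theta)$, this means $\partial_t u=\partial_r u_p+\theta_j'(r)\,\partial_\theta u_p$ and, for $r\neq0$, $\partial_n u=-r\theta_j'(r)\,\partial_r u_p+\tfrac1r\,\partial_\theta u_p$, evaluated at $(r,\theta_j(r))$. Let $u:\Omega\to\mathbb{C}$ be a $C^2$ solution of $\Delta u+k^2u=0$ in $\Omega$ such that for $j=1,2$ and all $r\in(-r_0,r_0)$ $$\alpha_j(r)\,u(\gamma_j(r))+\beta_j(r)\,\partial_t u(\gamma_j(r))+\tilde\beta_j(r)\,\partial_n u(\gamma_j(r))=0 .$$ If $u(0)=0$, then $u=0$ on $\Omega$. -/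

import Mathlib

open scoped Topology

noncomputable section

namespace RobinHelmholtz

/-- The Euclidean plane. -/
abbrev Plane : Type := EuclideanSpace ℝ (Fin 2)

/-- The point of the plane with polar coordinates `(r, φ)`; negative `r` is allowed. -/
def polarPoint (r φ : ℝ) : Plane := !₂[r * Real.cos φ, r * Real.sin φ]

/-- The curve `r ↦ (r cos θ(r), r sin θ(r))`, parametrized by the (signed) radius. -/
def polarCurve (θ : ℝ → ℝ) (r : ℝ) : Plane := polarPoint r (θ r)

/-- Counterclockwise rotation by a right angle. -/
def rotateRight (v : Plane) : Plane := !₂[-v 1, v 0]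

/-- Tangential derivative of `u` along the parametrized curve `γ`: the derivative of `u`
in the direction of the velocity vector `γ'(r)`. -/
def tangentialDeriv (u : Plane → ℂ) (γ : ℝ → Plane) (r : ℝ) : ℂ :=
  fderiv ℝ u (γ r) (deriv γ r)

/-- Normal derivative of `u` along the parametrized curve `γ`: the derivative of `u`
in the direction of `γ'(r)` rotated counterclockwise by a right angle. -/
def normalDeriv (u : Plane → ℂ) (γ : ℝ → Plane) (r : ℝ) : ℂ :=
  fderiv ℝ u (γ r) (rotateRight (deriv γ r))

/-- `u` is a (classical) solution of `Δu + k²u = 0` in `Ω`. -/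
structure IsHelmholtzSolution (Ω : Set Plane) (k : ℝ) (u : Plane → ℂ) : Prop where
  contDiffOn : ContDiffOn ℝ 2 u Ω
  equation : ∀ x ∈ Ω, Laplacian.laplacian u x + (k : ℂ) ^ 2 * u x = 0

/-- The condition `α u + β ∂ₜu + β' ∂ₙu = 0` on the curve
`{(r cos θ(r), r sin θ(r)) : -r₀ < r < r₀}`. -/
def RobinCondition (r₀ : ℝ) (α β β' θ : ℝ → ℝ) (u : Plane → ℂ) : Prop :=
  ∀ r ∈ Set.Ioo (-r₀) r₀,
    (α r : ℂ) * u (polarCurve θ r)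
      + (β r : ℂ) * tangentialDeriv u (polarCurve θ) r
      + (β' r : ℂ) * normalDeriv u (polarCurve θ) r = 0

/-- Non-degeneracy at `0`: if `β(0) = β'(0) = 0`, then `α(0) ≠ 0` and `β(r)`, `β'(r)` are
both `o(r)` as `r → 0`. -/
def NonDegenerate (α β β' : ℝ → ℝ) : Prop :=
  β 0 = 0 ∧ β' 0 = 0 →
    α 0 ≠ 0 ∧ β =o[𝓝 0] (fun r : ℝ => r) ∧ β' =o[𝓝 0] (fun r : ℝ => r)

/-- The phase `arg (β(0) + i β'(0))`, and `0` if `β(0) = β'(0) = 0`. -/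
def phase (β β' : ℝ → ℝ) : ℝ :=
  if β 0 = 0 ∧ β' 0 = 0 then 0 else Complex.arg ((β 0 : ℂ) + Complex.I * (β' 0 : ℂ))

theorem hasDerivAt_plane {f : ℝ → Plane} {f' : Plane} {r : ℝ}
    (h : ∀ i, HasDerivAt (fun s => f s i) (f' i) r) : HasDerivAt f f' r := by
  have h' : HasDerivAt (fun s => (f s).ofLp) f'.ofLp r := hasDerivAt_pi.2 h
  exact (PiLp.continuousLinearEquiv 2 ℝ (fun _ : Fin 2 => ℝ)).symm.hasFDerivAt.comp_hasDerivAt r h'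

theorem hasDerivAt_polarCurve {θ : ℝ → ℝ} {r : ℝ} (hθ : DifferentiableAt ℝ θ r) :
    HasDerivAt (polarCurve θ)
      !₂[Real.cos (θ r) + r * (-Real.sin (θ r) * deriv θ r),
        Real.sin (θ r) + r * (Real.cos (θ r) * deriv θ r)] r := by
  have h := hθ.hasDerivAt
  refine hasDerivAt_plane ?_
  intro i
  fin_cases i
  · simpa [polarCurve, polarPoint] using (hasDerivAt_id r).fun_mul h.cos
  · simpa [polarCurve, polarPoint] using (hasDerivAt_id r).fun_mul h.sin

theorem hasDerivAt_polarPoint_radial (r φ : ℝ) :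
    HasDerivAt (fun s => polarPoint s φ) !₂[Real.cos φ, Real.sin φ] r := by
  refine hasDerivAt_plane ?_
  intro i
  fin_cases i
  · simpa [polarPoint] using (hasDerivAt_id r).mul_const (Real.cos φ)
  · simpa [polarPoint] using (hasDerivAt_id r).mul_const (Real.sin φ)

theorem hasDerivAt_polarPoint_angular (r φ : ℝ) :
    HasDerivAt (fun ψ => polarPoint r ψ) (r • !₂[-Real.sin φ, Real.cos φ]) φ := by
  refine hasDerivAt_plane ?_
  intro i
  fin_cases i
  · simpa [polarPoint] using (Real.hasDerivAt_cos φ).const_mul r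
  · simpa [polarPoint] using (Real.hasDerivAt_sin φ).const_mul r

/-- In polar coordinates, `∂ₜu = ∂ᵣu + θ'(r) ∂_θ u`. -/
theorem tangentialDeriv_polarCurve {u : Plane → ℂ} {θ : ℝ → ℝ} {r : ℝ}
    (hθ : DifferentiableAt ℝ θ r) (hu : DifferentiableAt ℝ u (polarPoint r (θ r))) :
    tangentialDeriv u (polarCurve θ) r
      = deriv (fun s => u (polarPoint s (θ r))) r
        + ((deriv θ r : ℝ) : ℂ) * deriv (fun ψ => u (polarPoint r ψ)) (θ r) := by
  have h1 := (hu.hasFDerivAt.comp_hasDerivAt r (hasDerivAt_polarPoint_radial r (θ r))).deriv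
  have h2 := (hu.hasFDerivAt.comp_hasDerivAt (θ r)
    (hasDerivAt_polarPoint_angular r (θ r))).deriv
  simp only [Function.comp_def] at h1 h2
  rw [h1, h2, tangentialDeriv, (hasDerivAt_polarCurve hθ).deriv, ← Complex.real_smul,
    ← map_smul, ← map_add]
  congr 1
  ext i
  fin_cases i <;> simp <;> ring

/-- In polar coordinates, `∂ₙu = -r θ'(r) ∂ᵣu + r⁻¹ ∂_θ u` for `r ≠ 0`. -/
theorem normalDeriv_polarCurve {u : Plane → ℂ} {θ : ℝ → ℝ} {r : ℝ} (hr : r ≠ 0)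
    (hθ : DifferentiableAt ℝ θ r) (hu : DifferentiableAt ℝ u (polarPoint r (θ r))) :
    normalDeriv u (polarCurve θ) r
      = ((-(r * deriv θ r) : ℝ) : ℂ) * deriv (fun s => u (polarPoint s (θ r))) r
        + ((1 / r : ℝ) : ℂ) * deriv (fun ψ => u (polarPoint r ψ)) (θ r) := by
  have h1 := (hu.hasFDerivAt.comp_hasDerivAt r (hasDerivAt_polarPoint_radial r (θ r))).deriv
  have h2 := (hu.hasFDerivAt.comp_hasDerivAt (θ r)
    (hasDerivAt_polarPoint_angular r (θ r))).deriv
  simp only [Function.comp_def] at h1 h2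
  rw [h1, h2, normalDeriv, (hasDerivAt_polarCurve hθ).deriv, ← Complex.real_smul,
    ← Complex.real_smul, ← map_smul, ← map_smul, ← map_add]
  congr 1
  ext i
  fin_cases i <;> simp [rotateRight, hr] <;> ring

end RobinHelmholtz

end

open scoped Topology

/-! The coefficients are real, so the equation and both boundary conditions pass to each real
component of `u`, and it suffices to treat a real solution `U` near the origin, moved to the complex
plane. Write `k² = 4c`. The Vekua transform adds to `U` a Bessel-weighted integral along the segment
from `0` to `z`, and the result `H` is harmonic (`laplacian_vekuaTransform`). Hence `g = H_x - i
H_y` is holomorphic near `0`: it either vanishes identically or has a leading term `A zⁿ` with `A ≠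
0`. Since `U(0) = 0`, the gradients of `U` and `H` differ on the disc of radius `r` only by a factor
`O(r²)`, so `U` is zero near `0` or its differential is `v ↦ Re (A zⁿ v) + o(|z|ⁿ)`
(`helmholtz_local_dichotomy`).

In the first case unique continuation gives `U = 0` on the connected domain. In the second, rotation
by a right angle is multiplication by `i`, so the derivative terms of the condition act in the
direction `(β + iβ') γ'`. Letting `r → 0+` after division by the leading power of `r` gives `Re (A
exp(i((n+1)θ_j(0) + φ_j))) = 0` for both curves (`re_eq_zero_of_robin`). As `A ≠ 0`, the two phases
differ by a multiple of `π`, which the condition on `φ₁ - φ₂` forbids because `n + 1 ≠ 0`. -/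

namespace RobinHelmholtz

/-! ### Smoothness of parametric integrals, and a Bessel-type power series. -/

section ParametricIntegrals

open MeasureTheory intervalIntegral Set

section ParametricIntegral

variable {E F : Type} [NormedAddCommGroup E] [NormedSpace ℝ E] [ProperSpace E]
  [NormedAddCommGroup F] [NormedSpace ℝ F]

/-- Differentiation under the integral sign for a jointly `C¹` integrand. -/
theorem hasFDerivAt_integral_of_contDiff {f : E → ℝ → F}
    (hf : ContDiff ℝ 1 (fun p : E × ℝ => f p.1 p.2)) (z : E) :
    HasFDerivAt (fun y => ∫ t in (0 : ℝ)..1, f y t)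
      (∫ t in (0 : ℝ)..1, fderiv ℝ (fun y => f y t) z) z := by
  have hcont : Continuous (fun p : E × ℝ => fderiv ℝ (fun y => f y p.2) p.1) := by
    have : ContDiff ℝ 1 (fun q : (E × ℝ) × E => f q.2 q.1.2) :=
      hf.comp (contDiff_snd.prodMk contDiff_fst.snd)
    exact (ContDiff.fderiv (n := 0) (m := 1) (f := fun p : E × ℝ => fun y => f y p.2) this
      (contDiff_fst.of_le zero_le_one) (by simp)).continuous
  obtain ⟨C, hC⟩ := ((isCompact_closedBall z 1).prod (isCompact_Icc (a := (0 : ℝ)) (b := 1))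
    ).exists_bound_of_continuousOn hcont.continuousOn
  have hcont1 : ∀ y, Continuous (f y) := fun y =>
    hf.continuous.comp (continuous_const.prodMk continuous_id)
  refine intervalIntegral.hasFDerivAt_integral_of_dominated_of_fderiv_le
    (F' := fun y t => fderiv ℝ (fun y => f y t) y) (bound := fun _ => C)
    (Metric.ball_mem_nhds z one_pos) ?_ ?_ ?_ ?_ ?_ ?_
  · exact .of_forall fun y => (hcont1 y).aestronglyMeasurable
  · exact (hcont1 z).intervalIntegrable _ _
  · exact (hcont.comp (continuous_const.prodMk continuous_id)).aestronglyMeasurable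
  · refine .of_forall fun t ht y hy => hC (y, t) ⟨Metric.ball_subset_closedBall hy, ?_⟩
    rw [uIoc_of_le zero_le_one] at ht
    exact ⟨ht.1.le, ht.2⟩
  · exact intervalIntegrable_const
  · refine .of_forall fun t _ y _ => ?_
    have : ContDiff ℝ 1 (fun y => f y t) := hf.comp (contDiff_id.prodMk contDiff_const)
    exact (this.differentiable one_ne_zero y).hasFDerivAt

/-- The induction runs over all target spaces at once, because the derivative of the integral is
again such an integral, with values in `E →L[ℝ] F`. -/
theorem contDiff_integral_of_contDiff (n : ℕ) : ∀ {F : Type} [NormedAddCommGroup F]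
    [NormedSpace ℝ F] {f : E → ℝ → F},
    ContDiff ℝ n (fun p : E × ℝ => f p.1 p.2) →
    ContDiff ℝ n (fun y => ∫ t in (0 : ℝ)..1, f y t) := by
  induction n with
  | zero =>
    intro F _ _ f hf
    rw [Nat.cast_zero, contDiff_zero] at hf ⊢
    exact continuous_parametric_intervalIntegral_of_continuous' hf 0 1
  | succ n ih =>
    intro F _ _ f hf
    have h1 : ContDiff ℝ 1 (fun p : E × ℝ => f p.1 p.2) := hf.of_le (by norm_cast; omega)
    have hd := hasFDerivAt_integral_of_contDiff h1
    rw [Nat.cast_succ, contDiff_succ_iff_fderiv]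
    refine ⟨fun z => (hd z).differentiableAt, by simp, ?_⟩
    rw [show fderiv ℝ (fun y => ∫ t in (0 : ℝ)..1, f y t)
      = fun z => ∫ t in (0 : ℝ)..1, fderiv ℝ (fun y => f y t) z from funext fun z => (hd z).fderiv]
    apply ih
    have : ContDiff ℝ ((n + 1 : ℕ) : WithTop ℕ∞) (fun q : (E × ℝ) × E => f q.2 q.1.2) :=
      hf.comp (contDiff_snd.prodMk contDiff_fst.snd)
    exact ContDiff.fderiv (f := fun p : E × ℝ => fun y => f y p.2) this contDiff_fst (by simp)

end ParametricIntegral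

/-- The modified Bessel type entire function `∑ wʲ / (j! (j + m)!)`. -/
noncomputable def besselSeries (m : ℕ) (w : ℝ) : ℝ :=
  ∑' j : ℕ, w ^ j / ((j.factorial : ℝ) * ((j + m).factorial : ℝ))

theorem norm_besselSeries_term_le (m : ℕ) (w : ℝ) (j : ℕ) :
    ‖w ^ j / ((j.factorial : ℝ) * ((j + m).factorial : ℝ))‖ ≤ |w| ^ j / j.factorial := by
  have h1 : (1 : ℝ) ≤ ((j + m).factorial : ℝ) := by exact_mod_cast Nat.one_le_iff_ne_zero.2 (Nat.factorial_ne_zero _)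
  have h0 : (0 : ℝ) < j.factorial := by exact_mod_cast Nat.factorial_pos _
  rw [norm_div, norm_pow, Real.norm_eq_abs, Real.norm_of_nonneg (by positivity)]
  gcongr
  nlinarith

theorem summable_besselSeries (m : ℕ) (w : ℝ) :
    Summable fun j : ℕ => w ^ j / ((j.factorial : ℝ) * ((j + m).factorial : ℝ)) :=
  Summable.of_norm_bounded (Real.summable_pow_div_factorial |w|) (norm_besselSeries_term_le m w)

/-- Termwise differentiation cancels a factor of `j!`; shifting `j` by one then raises the order
from `m` to `m + 1`. -/
theorem hasDerivAt_besselSeries (m : ℕ) (w : ℝ) :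
    HasDerivAt (besselSeries m) (besselSeries (m + 1) w) w := by
  set R : ℝ := |w| + 1
  have hR : 0 ≤ R := by positivity
  have key : HasDerivAt (besselSeries m)
      (∑' j : ℕ, (j : ℝ) * w ^ (j - 1) / ((j.factorial : ℝ) * ((j + m).factorial : ℝ))) w := by
    refine hasDerivAt_tsum_of_isPreconnected (t := Metric.ball 0 R)
      (u := fun j : ℕ => (j : ℝ) * R ^ (j - 1) / j.factorial) (y₀ := 0)
      (g := fun j (w : ℝ) => w ^ j / ((j.factorial : ℝ) * ((j + m).factorial : ℝ)))
      (g' := fun j w => (j : ℝ) * w ^ (j - 1) / ((j.factorial : ℝ) * ((j + m).factorial : ℝ)))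
      ?_ Metric.isOpen_ball
      (convex_ball _ _).isPreconnected ?_ ?_ (Metric.mem_ball_self (by positivity))
      (summable_besselSeries m 0) (by simp [R])
    · rw [← summable_nat_add_iff 1]
      refine (Real.summable_pow_div_factorial R).congr fun j => ?_
      rw [Nat.factorial_succ]
      push_cast
      field_simp
    · exact fun j y _ => (hasDerivAt_pow j y).div_const _
    · intro j y hy
      have h1 : (1 : ℝ) ≤ ((j + m).factorial : ℝ) := by
        exact_mod_cast Nat.one_le_iff_ne_zero.2 (Nat.factorial_ne_zero _)
      have h0 : (0 : ℝ) < j.factorial := by exact_mod_cast Nat.factorial_pos _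
      have hy' : |y| ≤ R := by simpa using (mem_ball_zero_iff.1 hy).le
      rw [norm_div, norm_mul, norm_pow, Real.norm_eq_abs, Real.norm_eq_abs, Real.norm_of_nonneg (by positivity),
        Nat.abs_cast]
      gcongr
      nlinarith
  convert key using 1
  have hs : Summable fun j : ℕ => (j : ℝ) * w ^ (j - 1) /
      ((j.factorial : ℝ) * ((j + m).factorial : ℝ)) := by
    rw [← summable_nat_add_iff 1]
    refine (summable_besselSeries (m + 1) w).congr fun j => ?_
    rw [Nat.factorial_succ, show j + 1 + m = j + (m + 1) by ring]
    push_cast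
    field_simp
  rw [hs.tsum_eq_zero_add, besselSeries]
  simp only [Nat.cast_zero, zero_mul, zero_div, zero_add]
  refine tsum_congr fun j => ?_
  rw [Nat.factorial_succ, show j + 1 + m = j + (m + 1) by ring]
  push_cast
  field_simp

theorem contDiff_besselSeries (m : ℕ) {n : ℕ} : ContDiff ℝ n (besselSeries m) := by
  induction n generalizing m with
  | zero =>
    exact contDiff_zero.2 (continuous_iff_continuousAt.2
      fun w => (hasDerivAt_besselSeries m w).continuousAt)
  | succ n ih =>
    rw [Nat.cast_succ, contDiff_succ_iff_deriv]
    refine ⟨fun w => (hasDerivAt_besselSeries m w).differentiableAt, by simp, ?_⟩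
    rw [show deriv (besselSeries m) = besselSeries (m + 1) from
      funext fun w => (hasDerivAt_besselSeries m w).deriv]
    exact ih _

/-- For `j ≥ 1`, compare coefficients of `wʲ`: over the common denominator `j! (j+m+1)!` the
numerators are `j` and `m + 1`, with sum `j + m + 1`. -/
theorem besselSeries_recurrence (m : ℕ) (w : ℝ) :
    w * besselSeries (m + 2) w + (m + 1) * besselSeries (m + 1) w = besselSeries m w := by
  have h : ∀ j : ℕ, (0 : ℝ) < j.factorial := fun j => by exact_mod_cast Nat.factorial_pos _
  simp only [besselSeries]
  rw [(summable_besselSeries m w).tsum_eq_zero_add,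
    (summable_besselSeries (m + 1) w).tsum_eq_zero_add, mul_add, ← tsum_mul_left, ← tsum_mul_left,
    add_left_comm]
  congr 1
  · simp only [pow_zero, zero_add, Nat.factorial_succ, Nat.factorial_zero]
    have := h m
    push_cast
    field_simp
  · rw [← Summable.tsum_add]
    · refine tsum_congr fun j => ?_
      have h1 := h j
      have h2 := h (j + 1 + m)
      rw [show j + (m + 2) = (j + 1 + m) + 1 by ring, show j + 1 + (m + 1) = (j + 1 + m) + 1 by ring,
        Nat.factorial_succ (j + 1 + m), Nat.factorial_succ j]
      push_cast
      field_simp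
      ring
    · exact (summable_besselSeries (m + 2) w).mul_left _
    · exact ((summable_nat_add_iff 1).2 (summable_besselSeries (m + 1) w)).mul_left _

end ParametricIntegrals

/-! ### The Vekua transform from Helmholtz solutions to harmonic functions. -/

section VekuaTransform

open MeasureTheory intervalIntegral Set

/-- The second derivative along a line computes the second derivative in a direction. -/
theorem iteratedFDeriv_two_eq_of_line {E F : Type*} [NormedAddCommGroup E] [NormedSpace ℝ E]
    [NormedAddCommGroup F] [NormedSpace ℝ F] {f : E → F} (hf : ContDiff ℝ 2 f) {z v : E}
    {h₁ : ℝ → F} {h₂ : F} (H₁ : ∀ s, HasDerivAt (fun s : ℝ => f (z + s • v)) (h₁ s) s)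
    (H₂ : HasDerivAt h₁ h₂ 0) : iteratedFDeriv ℝ 2 f z ![v, v] = h₂ := by
  have hl : ∀ s : ℝ, HasDerivAt (fun s : ℝ => z + s • v) v s := fun s => by
    simpa using ((hasDerivAt_id s).smul_const v).const_add z
  have e₁ : h₁ = fun s => fderiv ℝ f (z + s • v) v := funext fun s =>
    (H₁ s).unique ((hf.differentiable two_ne_zero _).hasFDerivAt.comp_hasDerivAt s (hl s))
  have hd : Differentiable ℝ (fderiv ℝ f) :=
    (hf.fderiv_right (m := 1) (by norm_num)).differentiable one_ne_zero
  have h3 : HasDerivAt (fun s : ℝ => fderiv ℝ f (z + s • v))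
      (fderiv ℝ (fderiv ℝ f) (z + (0 : ℝ) • v) v) 0 :=
    (hd _).hasFDerivAt.comp_hasDerivAt (0 : ℝ) (hl 0)
  have h4 := h3.clm_apply (hasDerivAt_const (0 : ℝ) v)
  rw [e₁] at H₂
  rw [iteratedFDeriv_two_apply, H₂.unique h4]
  simp

theorem hasDerivAt_line_iteratedFDeriv_two {E F : Type*} [NormedAddCommGroup E] [NormedSpace ℝ E]
    [NormedAddCommGroup F] [NormedSpace ℝ F] {f : E → F} (hf : ContDiff ℝ 2 f) (z v : E) :
    HasDerivAt (fun s : ℝ => fderiv ℝ f (z + s • v) v) (iteratedFDeriv ℝ 2 f z ![v, v]) 0 := by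
  have hl : HasDerivAt (fun s : ℝ => z + s • v) v 0 := by
    simpa using ((hasDerivAt_id (0 : ℝ)).smul_const v).const_add z
  have hd : Differentiable ℝ (fderiv ℝ f) :=
    (hf.fderiv_right (m := 1) (by norm_num)).differentiable one_ne_zero
  have h3 : HasDerivAt (fun s : ℝ => fderiv ℝ f (z + s • v))
      (fderiv ℝ (fderiv ℝ f) (z + (0 : ℝ) • v) v) 0 :=
    (hd _).hasFDerivAt.comp_hasDerivAt (0 : ℝ) hl
  have h4 := h3.clm_apply (hasDerivAt_const (0 : ℝ) v)
  simpa [iteratedFDeriv_two_apply] using h4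

theorem iteratedFDeriv_two_integral {E F : Type} [NormedAddCommGroup E] [NormedSpace ℝ E]
    [ProperSpace E] [NormedAddCommGroup F] [NormedSpace ℝ F] [CompleteSpace F] {f : E → ℝ → F}
    (hf : ContDiff ℝ 2 (fun p : E × ℝ => f p.1 p.2)) (z v : E) :
    IntervalIntegrable (fun t => iteratedFDeriv ℝ 2 (fun y => f y t) z ![v, v]) volume 0 1 ∧
    iteratedFDeriv ℝ 2 (fun y => ∫ t in (0 : ℝ)..1, f y t) z ![v, v]
      = ∫ t in (0 : ℝ)..1, iteratedFDeriv ℝ 2 (fun y => f y t) z ![v, v] := by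
  have h1 : ContDiff ℝ 1 (fun p : E × ℝ => fderiv ℝ (fun y => f y p.2) p.1) := by
    have : ContDiff ℝ 2 (fun q : (E × ℝ) × E => f q.2 q.1.2) :=
      hf.comp (contDiff_snd.prodMk contDiff_fst.snd)
    exact ContDiff.fderiv (f := fun p : E × ℝ => fun y => f y p.2) this contDiff_fst (by norm_num)
  have h2 : ContDiff ℝ 0
      (fun p : E × ℝ => fderiv ℝ (fun y => fderiv ℝ (fun y => f y p.2) y) p.1) := by
    have : ContDiff ℝ 1 (fun q : (E × ℝ) × E => fderiv ℝ (fun y => f y q.1.2) q.2) :=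
      h1.comp (contDiff_snd.prodMk contDiff_fst.snd)
    exact ContDiff.fderiv (f := fun p : E × ℝ => fun y => fderiv ℝ (fun y => f y p.2) y) this
      contDiff_fst (by norm_num)
  have h3 : Continuous (fun t : ℝ => fderiv ℝ (fun y => fderiv ℝ (fun y => f y t) y) z) :=
    h2.continuous.comp (continuous_const.prodMk continuous_id)
  simp only [iteratedFDeriv_two_apply, Matrix.cons_val_zero, Matrix.cons_val_one]
  refine ⟨((h3.clm_apply continuous_const).clm_apply continuous_const).intervalIntegrable _ _, ?_⟩
  rw [show fderiv ℝ (fun y => ∫ t in (0 : ℝ)..1, f y t)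
      = fun z => ∫ t in (0 : ℝ)..1, fderiv ℝ (fun y => f y t) z from
      funext fun z => (hasFDerivAt_integral_of_contDiff (hf.of_le (by norm_num)) z).fderiv,
    (hasFDerivAt_integral_of_contDiff h1 z).fderiv,
    ContinuousLinearMap.intervalIntegral_apply (h3.intervalIntegrable _ _),
    ContinuousLinearMap.intervalIntegral_apply
      ((h3.clm_apply continuous_const).intervalIntegrable _ _)]

/-- The squared modulus, as a polynomial in the coordinates. -/
def sqModulus (z : ℂ) : ℝ := z.re ^ 2 + z.im ^ 2

theorem sqModulus_eq (z : ℂ) : sqModulus z = ‖z‖ ^ 2 := by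
  rw [← Complex.normSq_eq_norm_sq, Complex.normSq_apply, sqModulus]; ring

theorem contDiff_sqModulus {n : WithTop ℕ∞} : ContDiff ℝ n sqModulus :=
  (Complex.reCLM.contDiff.pow 2).add (Complex.imCLM.contDiff.pow 2)

/-- The kernel of the Vekua transform, as a function of the squared radius `s`. -/
noncomputable def vekuaKernel (c t s : ℝ) : ℝ := c * s * besselSeries 1 (c * s * (t * (1 - t)))

/-- With `w = c s t (1 - t)`, the product rule gives `c` times the left side of the recurrence for
`m = 0`, which collapses to order `0`. -/
theorem hasDerivAt_vekuaKernel (c t s : ℝ) :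
    HasDerivAt (vekuaKernel c t) (c * besselSeries 0 (c * s * (t * (1 - t)))) s := by
  have h1 : HasDerivAt (fun s : ℝ => c * s) c s := by simpa using (hasDerivAt_id s).const_mul c
  have h2 := (hasDerivAt_besselSeries 1 (c * s * (t * (1 - t)))).comp s (h1.mul_const (t * (1 - t)))
  refine (h1.mul h2).congr_deriv ?_
  rw [← besselSeries_recurrence 0]
  simp only [Function.comp_apply]
  push_cast
  ring

theorem hasDerivAt_deriv_vekuaKernel (c t s : ℝ) :
    HasDerivAt (fun s => c * besselSeries 0 (c * s * (t * (1 - t))))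
      (c ^ 2 * (t * (1 - t)) * besselSeries 1 (c * s * (t * (1 - t)))) s := by
  have h1 : HasDerivAt (fun s : ℝ => c * s) c s := by simpa using (hasDerivAt_id s).const_mul c
  have h2 := (hasDerivAt_besselSeries 0 (c * s * (t * (1 - t)))).comp s (h1.mul_const (t * (1 - t)))
  refine (h2.const_mul c).congr_deriv ?_
  ring

theorem contDiff_vekuaKernel (c : ℝ) {n : ℕ} :
    ContDiff ℝ n (fun p : ℂ × ℝ => vekuaKernel c p.2 (sqModulus p.1)) := by
  have h1 : ContDiff ℝ n (fun p : ℂ × ℝ => c * sqModulus p.1) :=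
    contDiff_const.mul (contDiff_sqModulus.comp contDiff_fst)
  have h2 : ContDiff ℝ n (fun p : ℂ × ℝ => p.2 * (1 - p.2)) :=
    contDiff_snd.mul (contDiff_const.sub contDiff_snd)
  exact h1.mul ((contDiff_besselSeries 1).comp (h1.mul h2))

theorem contDiff_vekuaIntegrand (c : ℝ) {n : ℕ} {U : ℂ → ℝ} (hU : ContDiff ℝ n U) :
    ContDiff ℝ n (fun p : ℂ × ℝ => vekuaKernel c p.2 (sqModulus p.1) * U (p.2 • p.1)) :=
  (contDiff_vekuaKernel c).mul (hU.comp (contDiff_snd.smul contDiff_fst))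

theorem iteratedFDeriv_two_vekuaIntegrand (c t : ℝ) {U : ℂ → ℝ} (hU : ContDiff ℝ 2 U) (z v : ℂ) :
    iteratedFDeriv ℝ 2 (fun y => vekuaKernel c t (sqModulus y) * U (t • y)) z ![v, v]
      = (c ^ 2 * (t * (1 - t)) * besselSeries 1 (c * sqModulus z * (t * (1 - t))))
            * (2 * (z.re * v.re + z.im * v.im)) ^ 2 * U (t • z)
        + (c * besselSeries 0 (c * sqModulus z * (t * (1 - t)))) * (2 * sqModulus v) * U (t • z)
        + 2 * (c * besselSeries 0 (c * sqModulus z * (t * (1 - t))))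
            * (2 * (z.re * v.re + z.im * v.im)) * (t * fderiv ℝ U (t • z) v)
        + vekuaKernel c t (sqModulus z) * (t ^ 2 * iteratedFDeriv ℝ 2 U (t • z) ![v, v]) := by
  have hf : ContDiff ℝ 2 (fun y : ℂ => vekuaKernel c t (sqModulus y) * U (t • y)) :=
    (contDiff_vekuaIntegrand c (n := 2) hU).comp (contDiff_id.prodMk contDiff_const)
  have hq : ∀ s : ℝ, sqModulus (z + s • v)
      = sqModulus z + s * (2 * (z.re * v.re + z.im * v.im)) + s ^ 2 * sqModulus v := fun s => by
    simp [sqModulus]; ring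
  have hq' : ∀ s : ℝ, HasDerivAt (fun s : ℝ => sqModulus (z + s • v))
      (2 * (z.re * v.re + z.im * v.im) + 2 * s * sqModulus v) s := fun s => by
    simp only [hq]
    have := (((hasDerivAt_id s).mul_const (2 * (z.re * v.re + z.im * v.im))).const_add
      (sqModulus z)).add ((hasDerivAt_pow 2 s).mul_const (sqModulus v))
    exact this.congr_deriv (by simp)
  have hl : ∀ s : ℝ, HasDerivAt (fun s : ℝ => t • (z + s • v)) (t • v) s := fun s => by
    exact ((((hasDerivAt_id s).smul_const v).const_add z).const_smul t).congr_deriv (by simp)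
  have hU1 : ∀ s : ℝ, HasDerivAt (fun s : ℝ => U (t • (z + s • v)))
      (t * fderiv ℝ U (t • (z + s • v)) v) s := fun s => by
    have := (hU.differentiable two_ne_zero (t • (z + s • v))).hasFDerivAt.comp_hasDerivAt s (hl s)
    exact this.congr_deriv (by rw [map_smul, smul_eq_mul])
  have hU2 : HasDerivAt (fun s : ℝ => fderiv ℝ U (t • (z + s • v)) v)
      (t * iteratedFDeriv ℝ 2 U (t • z) ![v, v]) 0 := by
    have h1 := hasDerivAt_line_iteratedFDeriv_two hU (t • z) v
    have h2 : HasDerivAt (fun s : ℝ => t * s) t 0 := by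
      simpa using (hasDerivAt_id (0 : ℝ)).const_mul t
    -- The base point is written as `t * 0` so that the derivative composes with `s ↦ t * s`.
    rw [← mul_zero t] at h1
    refine ((HasDerivAt.scomp (0 : ℝ) h1 h2).congr_deriv (by simp)).congr_of_eventuallyEq ?_
    exact .of_forall fun s => by simp [mul_assoc]
  have hk : ∀ s : ℝ, HasDerivAt (fun s : ℝ => vekuaKernel c t (sqModulus (z + s • v)))
      (c * besselSeries 0 (c * sqModulus (z + s • v) * (t * (1 - t)))
        * (2 * (z.re * v.re + z.im * v.im) + 2 * s * sqModulus v)) s := fun s =>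
    (hasDerivAt_vekuaKernel c t _).comp s (hq' s)
  have hk2 : HasDerivAt (fun s : ℝ => c * besselSeries 0 (c * sqModulus (z + s • v) * (t * (1 - t))))
      (c ^ 2 * (t * (1 - t)) * besselSeries 1 (c * sqModulus (z + (0 : ℝ) • v) * (t * (1 - t)))
        * (2 * (z.re * v.re + z.im * v.im) + 2 * (0 : ℝ) * sqModulus v)) 0 :=
    (hasDerivAt_deriv_vekuaKernel c t _).comp (0 : ℝ) (hq' 0)
  have hlin : HasDerivAt (fun s : ℝ => 2 * (z.re * v.re + z.im * v.im) + 2 * s * sqModulus v)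
      (2 * sqModulus v) 0 := by
    simpa using (((hasDerivAt_id (0 : ℝ)).const_mul 2).mul_const (sqModulus v)).const_add
      (2 * (z.re * v.re + z.im * v.im))
  rw [iteratedFDeriv_two_eq_of_line hf (fun s => (hk s).mul (hU1 s))
    (((hk2.mul hlin).mul (hU1 0)).add ((hk 0).mul (hU2.const_mul t)))]
  simp only [Pi.mul_apply, zero_smul, add_zero, mul_zero, zero_mul]
  ring

/-- The Vekua transform, which turns solutions of `Δu + 4cu = 0` into harmonic functions. -/
noncomputable def vekuaTransform (c : ℝ) (U : ℂ → ℝ) (z : ℂ) : ℝ :=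
  U z + ∫ t in (0 : ℝ)..1, vekuaKernel c t (sqModulus z) * U (t • z)

theorem contDiff_vekuaTransform (c : ℝ) {U : ℂ → ℝ} (hU : ContDiff ℝ 2 U) :
    ContDiff ℝ 2 (vekuaTransform c U) :=
  hU.add (contDiff_integral_of_contDiff (E := ℂ) 2
    (f := fun z t => vekuaKernel c t (sqModulus z) * U (t • z)) (contDiff_vekuaIntegrand c hU))

theorem fderiv_apply_eq_re_im (L : ℂ →L[ℝ] ℝ) (z : ℂ) : L z = z.re * L 1 + z.im * L Complex.I := by
  conv_lhs => rw [show z = z.re • (1 : ℂ) + z.im • Complex.I by simp [Complex.re_add_im]]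
  rw [map_add, map_smul, map_smul, smul_eq_mul, smul_eq_mul]

/-- The Laplacian of the integrand is an exact derivative in `t`, so the integral contributes only
boundary values, and these cancel `ΔU`. -/
theorem laplacian_vekuaTransform {c : ℝ} {U : ℂ → ℝ} (hU : ContDiff ℝ 2 U) {R : ℝ}
    (hLap : ∀ z ∈ Metric.ball (0 : ℂ) R, Laplacian.laplacian U z = -(4 * c) * U z) :
    ∀ z ∈ Metric.ball (0 : ℂ) R, Laplacian.laplacian (vekuaTransform c U) z = 0 := by
  intro z hz
  have hJ : ContDiff ℝ 2 (fun z : ℂ => ∫ t in (0 : ℝ)..1, vekuaKernel c t (sqModulus z) * U (t • z)) :=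
    contDiff_integral_of_contDiff (E := ℂ) 2
      (f := fun z t => vekuaKernel c t (sqModulus z) * U (t • z)) (contDiff_vekuaIntegrand c hU)
  have hint := iteratedFDeriv_two_integral (E := ℂ)
    (f := fun z t => vekuaKernel c t (sqModulus z) * U (t • z))
    (contDiff_vekuaIntegrand c (n := 2) hU) z
  have h1 := hU.contDiffAt.laplacian_add hJ.contDiffAt (x := z)
  have h2 : vekuaTransform c U
    = U + fun z : ℂ => ∫ t in (0 : ℝ)..1, vekuaKernel c t (sqModulus z) * U (t • z) := rfl
  rw [h2, h1, hLap z hz, InnerProductSpace.laplacian_eq_iteratedFDeriv_complexPlane]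
  simp only
  rw [(hint 1).2, (hint Complex.I).2, ← integral_add (hint 1).1 (hint Complex.I).1]
  -- `Q` is the antiderivative: it vanishes at `t = 0` and equals `4c U(z)` at `t = 1`, since the
  -- order-zero series is `1` at `0`.
  set Q : ℝ → ℝ := fun t => 4 * t * (c * besselSeries 0 (c * sqModulus z * (t * (1 - t)))) * U (t • z)
    with hQ
  rw [integral_eq_sub_of_hasDerivAt (f := Q) _ ((hint 1).1.add (hint Complex.I).1)]
  · have : besselSeries 0 0 = 1 := by
      rw [besselSeries, tsum_eq_single 0 (fun j hj => by simp [hj])]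
      simp
    simp [hQ, this]
  · intro t ht
    rw [uIcc_of_le zero_le_one] at ht
    have hp : HasDerivAt (fun t : ℝ => c * sqModulus z * (t * (1 - t)))
        (c * sqModulus z * (1 - 2 * t)) t := by
      refine ((((hasDerivAt_id t).mul ((hasDerivAt_id t).const_sub 1))).const_mul
        (c * sqModulus z)).congr_deriv ?_
      simp only [id]
      ring
    have hB := ((hasDerivAt_besselSeries 0 (c * sqModulus z * (t * (1 - t)))).comp t hp).const_mul c
    have hl : HasDerivAt (fun t : ℝ => t • z) z t := by
      simpa using (hasDerivAt_id t).smul_const z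
    have hUl : HasDerivAt (fun t : ℝ => U (t • z)) (fderiv ℝ U (t • z) z) t :=
      (hU.differentiable two_ne_zero (t • z)).hasFDerivAt.comp_hasDerivAt t hl
    have h4 : HasDerivAt (fun t : ℝ => 4 * t) 4 t := by simpa using (hasDerivAt_id t).const_mul 4
    refine ((h4.mul hB).mul hUl).congr_deriv ?_
    have htz : t • z ∈ Metric.ball (0 : ℂ) R := by
      rw [mem_ball_zero_iff] at hz ⊢
      rw [norm_smul, Real.norm_of_nonneg ht.1]
      nlinarith [norm_nonneg z, ht.2]
    -- The equation at `t z` removes the second derivatives of `U`; what remains matches `Q'` term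
    -- by term.
    have hL := hLap _ htz
    rw [InnerProductSpace.laplacian_eq_iteratedFDeriv_complexPlane] at hL
    simp only at hL
    rw [iteratedFDeriv_two_vekuaIntegrand c t hU, iteratedFDeriv_two_vekuaIntegrand c t hU,
      fderiv_apply_eq_re_im _ z, eq_sub_of_add_eq hL]
    simp only [Pi.mul_apply, Function.comp_apply, Complex.one_re, Complex.one_im, Complex.I_re, Complex.I_im,
      sqModulus, vekuaKernel, zero_add]
    ring

end VekuaTransform

/-! ### Gradient comparison and the leading term at a zero. -/

section LocalStructure

open MeasureTheory intervalIntegral Set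

/-- The real linear functional `v ↦ Re (a v)`. -/
noncomputable def reMul (a : ℂ) : ℂ →L[ℝ] ℝ := Complex.reCLM.comp (ContinuousLinearMap.mul ℝ ℂ a)

theorem reMul_apply (a v : ℂ) : reMul a v = (a * v).re := rfl

theorem norm_reMul_le (a : ℂ) : ‖reMul a‖ ≤ ‖a‖ := by
  refine ContinuousLinearMap.opNorm_le_bound _ (norm_nonneg _) fun v => ?_
  rw [reMul_apply, ← norm_mul]
  exact Complex.abs_re_le_norm _

theorem le_norm_reMul (a : ℂ) : ‖a‖ ≤ ‖reMul a‖ := by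
  by_cases ha : a = 0
  · simp [ha]
  -- The conjugate of `a` is the direction in which the functional attains its norm.
  have h := (reMul a).le_opNorm (starRingEnd ℂ a)
  rw [reMul_apply, Complex.mul_conj, Complex.ofReal_re, Complex.normSq_eq_norm_sq, Complex.norm_conj,
    Real.norm_of_nonneg (by positivity)] at h
  have : 0 < ‖a‖ := norm_pos_iff.2 ha
  nlinarith

theorem reMul_sub (a b : ℂ) : reMul (a - b) = reMul a - reMul b := by
  ext
  simp [reMul_apply, sub_mul]

theorem hasFDerivAt_sqModulus (z : ℂ) : HasFDerivAt sqModulus (2 • innerSL ℝ z) z := by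
  rw [show sqModulus = fun z => ‖z‖ ^ 2 from funext sqModulus_eq]
  exact (hasStrictFDerivAt_norm_sq z).hasFDerivAt

/-- On the unit disc the series argument stays in the compact interval `[-|c|, |c|]`; the powers of
`‖z‖` come from the prefactor `c s` with `s = ‖z‖²` and from the gradient of `s`. -/
theorem exists_vekuaKernel_bound (c : ℝ) : ∃ C > 0, ∀ z : ℂ, ‖z‖ ≤ 1 → ∀ t ∈ Icc (0 : ℝ) 1,
    ‖vekuaKernel c t (sqModulus z)‖ ≤ C * ‖z‖ ^ 2 ∧
    ‖fderiv ℝ (fun y => vekuaKernel c t (sqModulus y)) z‖ ≤ C * ‖z‖ := by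
  have hb : ∀ m, ∃ M, ∀ w ∈ Icc (-|c|) |c|, ‖besselSeries m w‖ ≤ M := fun m =>
    isCompact_Icc.exists_bound_of_continuousOn (contDiff_besselSeries m (n := 0)).continuous.continuousOn
  obtain ⟨M₀, hM₀⟩ := hb 0
  obtain ⟨M₁, hM₁⟩ := hb 1
  have h0 : (0 : ℝ) ∈ Icc (-|c|) |c| := by simp
  have hp₀ : 0 ≤ M₀ := (norm_nonneg _).trans (hM₀ 0 h0)
  have hp₁ : 0 ≤ M₁ := (norm_nonneg _).trans (hM₁ 0 h0)
  refine ⟨|c| * M₁ + 2 * (|c| * M₀) + 1, by positivity, fun z hz t ht => ?_⟩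
  have hw : c * sqModulus z * (t * (1 - t)) ∈ Icc (-|c|) |c| := by
    rw [mem_Icc, ← abs_le, abs_mul, abs_mul, mul_assoc]
    refine mul_le_of_le_one_right (abs_nonneg c) ?_
    rw [sqModulus_eq, abs_of_nonneg (by positivity),
      abs_of_nonneg (mul_nonneg ht.1 (by linarith [ht.2]))]
    have h1 : ‖z‖ ^ 2 ≤ 1 := by nlinarith [norm_nonneg z]
    have h2 : t * (1 - t) ≤ 1 := by nlinarith [ht.1, ht.2]
    have h3 : 0 ≤ t * (1 - t) := mul_nonneg ht.1 (by linarith [ht.2])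
    nlinarith [sq_nonneg ‖z‖]
  have hK : ‖vekuaKernel c t (sqModulus z)‖ ≤ |c| * M₁ * ‖z‖ ^ 2 := by
    rw [vekuaKernel, norm_mul, norm_mul, sqModulus_eq, Real.norm_eq_abs c,
      Real.norm_of_nonneg (by positivity : 0 ≤ ‖z‖ ^ 2), ← sqModulus_eq]
    have := hM₁ _ hw
    rw [mul_right_comm]
    have hq : 0 ≤ sqModulus z := by rw [sqModulus_eq]; positivity
    gcongr
  have hd : HasFDerivAt (fun y => vekuaKernel c t (sqModulus y))
      ((c * besselSeries 0 (c * sqModulus z * (t * (1 - t)))) • (2 • innerSL ℝ z)) z :=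
    (hasDerivAt_vekuaKernel c t _).comp_hasFDerivAt z (hasFDerivAt_sqModulus z)
  have hD : ‖fderiv ℝ (fun y => vekuaKernel c t (sqModulus y)) z‖ ≤ 2 * (|c| * M₀) * ‖z‖ := by
    rw [hd.fderiv, norm_smul, norm_mul, Real.norm_eq_abs c]
    have h1 := hM₀ _ hw
    have h2 : ‖(2 : ℕ) • innerSL ℝ z‖ ≤ 2 * ‖z‖ := by
      refine (norm_nsmul_le).trans ?_
      rw [innerSL_apply_norm]
      simp
    calc _ ≤ |c| * M₀ * (2 * ‖z‖) := by gcongr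
      _ = _ := by ring
  constructor
  · refine hK.trans ?_
    gcongr
    linarith [mul_nonneg (abs_nonneg c) hp₀]
  · refine hD.trans ?_
    gcongr
    linarith [mul_nonneg (abs_nonneg c) hp₁]

theorem norm_le_of_fderiv_le {U : ℂ → ℝ} (hU : Differentiable ℝ U) (hU0 : U 0 = 0) {r D : ℝ}
    (hD : ∀ z : ℂ, ‖z‖ ≤ r → ‖fderiv ℝ U z‖ ≤ D) {z : ℂ} (hz : ‖z‖ ≤ r) : ‖U z‖ ≤ D * ‖z‖ := by
  have := (convex_closedBall (0 : ℂ) r).norm_image_sub_le_of_norm_fderiv_le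
    (f := U) (C := D) (x := 0) (y := z) (𝕜 := ℝ) (fun x _ => hU x)
    (fun x hx => hD x (mem_closedBall_zero_iff.1 hx))
    (Metric.mem_closedBall_self ((norm_nonneg z).trans hz)) (mem_closedBall_zero_iff.2 hz)
  simpa [hU0] using this

/-- The differential of the integrand has two terms: kernel `O(r²)` times gradient `D`, and kernel
gradient `O(r)` times `|U| ≤ D r`. The latter bound is where `U 0 = 0` enters. -/
theorem exists_fderiv_vekuaTransform_bound (c : ℝ) : ∃ C > 0, ∀ U : ℂ → ℝ, ContDiff ℝ 2 U →
    U 0 = 0 → ∀ r ≤ 1, ∀ D, (∀ z : ℂ, ‖z‖ ≤ r → ‖fderiv ℝ U z‖ ≤ D) → ∀ z : ℂ, ‖z‖ ≤ r →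
      ‖fderiv ℝ (vekuaTransform c U) z - fderiv ℝ U z‖ ≤ C * r ^ 2 * D := by
  obtain ⟨C, hC, hb⟩ := exists_vekuaKernel_bound c
  refine ⟨2 * C, by positivity, fun U hU hU0 r hr D hD z hz => ?_⟩
  have hUd : Differentiable ℝ U := hU.differentiable two_ne_zero
  have hr0 : 0 ≤ r := (norm_nonneg z).trans hz
  have hD0 : 0 ≤ D := (norm_nonneg _).trans (hD z hz)
  have hI := hasFDerivAt_integral_of_contDiff (E := ℂ)
    (f := fun z t => vekuaKernel c t (sqModulus z) * U (t • z))
    ((contDiff_vekuaIntegrand c (n := 2) hU).of_le (by norm_num)) z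
  have hH : fderiv ℝ (vekuaTransform c U) z = _ := ((hUd z).hasFDerivAt.add hI).fderiv
  rw [hH, add_sub_cancel_left]
  refine (intervalIntegral.norm_integral_le_of_norm_le_const (C := 2 * C * r ^ 2 * D)
    fun t ht => ?_).trans (by simp)
  rw [uIoc_of_le zero_le_one] at ht
  have ht' : t ∈ Icc (0 : ℝ) 1 := ⟨ht.1.le, ht.2⟩
  have htz : ‖t • z‖ ≤ r := by
    rw [norm_smul, Real.norm_of_nonneg ht'.1]
    nlinarith [norm_nonneg z, ht.2]
  have hK : HasFDerivAt (fun y => vekuaKernel c t (sqModulus y))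
      (fderiv ℝ (fun y => vekuaKernel c t (sqModulus y)) z) z :=
    (((contDiff_vekuaKernel c (n := 1)).comp (contDiff_id.prodMk contDiff_const)).differentiable
      one_ne_zero z).hasFDerivAt
  have hUt : HasFDerivAt (fun y : ℂ => U (t • y)) (t • fderiv ℝ U (t • z)) z := by
    refine ((hUd (t • z)).hasFDerivAt.comp z ((hasFDerivAt_id z).const_smul t)).congr_fderiv ?_
    ext
    simp
  rw [(hK.fun_mul hUt).fderiv]
  obtain ⟨h1, h2⟩ := hb z (hz.trans hr) t ht'
  have h3 : ‖U (t • z)‖ ≤ D * r :=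
    (norm_le_of_fderiv_le hUd hU0 hD htz).trans (by gcongr)
  have h4 : ‖t • fderiv ℝ U (t • z)‖ ≤ D := by
    rw [norm_smul, Real.norm_of_nonneg ht'.1]
    have := hD _ htz
    nlinarith [norm_nonneg (fderiv ℝ U (t • z)), ht.2]
  calc _ ≤ ‖vekuaKernel c t (sqModulus z)‖ * ‖t • fderiv ℝ U (t • z)‖
        + ‖U (t • z)‖ * ‖fderiv ℝ (fun y => vekuaKernel c t (sqModulus y)) z‖ := by
        exact (norm_add_le _ _).trans (add_le_add
          (ContinuousLinearMap.opNorm_smul_le _ _) (ContinuousLinearMap.opNorm_smul_le _ _))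
    _ ≤ C * r ^ 2 * D + D * r * (C * r) := by
        have h1' : ‖vekuaKernel c t (sqModulus z)‖ ≤ C * r ^ 2 := h1.trans (by gcongr)
        have h2' : ‖fderiv ℝ (fun y => vekuaKernel c t (sqModulus y)) z‖ ≤ C * r :=
          h2.trans (by gcongr)
        gcongr
    _ = _ := by ring

/-- On small discs the gradient of `U` is controlled by that of its Vekua transform. -/
theorem exists_fderiv_bound_of_vekuaTransform (c : ℝ) : ∃ C > 0, ∃ ρ > 0, ∀ U : ℂ → ℝ,
    ContDiff ℝ 2 U → U 0 = 0 → ∀ r ≤ ρ, ∀ B,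
    (∀ z : ℂ, ‖z‖ ≤ r → ‖fderiv ℝ (vekuaTransform c U) z‖ ≤ B) → ∀ z : ℂ, ‖z‖ ≤ r →
      ‖fderiv ℝ U z‖ ≤ 2 * B ∧
      ‖fderiv ℝ U z - fderiv ℝ (vekuaTransform c U) z‖ ≤ C * r ^ 2 * B := by
  obtain ⟨C, hC, hb⟩ := exists_fderiv_vekuaTransform_bound c
  -- The radius makes `C r² ≤ 1/2`. If `D` is the maximum of `‖fderiv ℝ U‖` on the disc, then `D ≤ B
  -- + D/2`, so `D ≤ 2B`.
  refine ⟨2 * C, by positivity, min 1 (1 / (2 * C)), by positivity,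
    fun U hU hU0 r hr B hB z hz => ?_⟩
  have hr0 : 0 ≤ r := (norm_nonneg z).trans hz
  have hr1 : r ≤ 1 := hr.trans (min_le_left _ _)
  have hrC : C * r ^ 2 ≤ 1 / 2 := by
    have h1 : r ≤ 1 / (2 * C) := hr.trans (min_le_right _ _)
    have h2 : C * r ≤ 1 / 2 := by
      calc C * r ≤ C * (1 / (2 * C)) := by gcongr
        _ = 1 / 2 := by field_simp
    nlinarith
  have hcont : Continuous (fderiv ℝ U) := hU.continuous_fderiv two_ne_zero
  obtain ⟨y, hy, hmax⟩ := (isCompact_closedBall (0 : ℂ) r).exists_isMaxOn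
    ⟨0, Metric.mem_closedBall_self hr0⟩ hcont.norm.continuousOn
  have hD : ∀ x : ℂ, ‖x‖ ≤ r → ‖fderiv ℝ U x‖ ≤ ‖fderiv ℝ U y‖ := fun x hx =>
    hmax (mem_closedBall_zero_iff.2 hx)
  rw [mem_closedBall_zero_iff] at hy
  have key := hb U hU hU0 r hr1 _ hD
  have h1 := key y hy
  have h2 : ‖fderiv ℝ U y‖ ≤ 2 * B := by
    have h3 : ‖fderiv ℝ U y‖ ≤ ‖fderiv ℝ (vekuaTransform c U) y‖
        + ‖fderiv ℝ (vekuaTransform c U) y - fderiv ℝ U y‖ := norm_le_norm_add_norm_sub _ _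
    have h4 := hB y hy
    nlinarith [norm_nonneg (fderiv ℝ U y)]
  refine ⟨(hD z hz).trans h2, ?_⟩
  rw [norm_sub_rev]
  refine (key z hz).trans ?_
  calc C * r ^ 2 * ‖fderiv ℝ U y‖ ≤ C * r ^ 2 * (2 * B) := by gcongr
    _ = _ := by ring

/-- Near `0`, a solution vanishing at `0` is either trivial or led by a harmonic monomial. -/
theorem helmholtz_local_dichotomy (c : ℝ) : ∃ ρ > 0, ∀ R > 0, ∀ U : ℂ → ℝ, ContDiff ℝ 2 U →
    U 0 = 0 →
    (∀ z ∈ Metric.ball (0 : ℂ) R, Laplacian.laplacian U z = -(4 * c) * U z) →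
    (∀ z ∈ Metric.ball (0 : ℂ) (min R ρ), U z = 0) ∨
    ∃ (n : ℕ) (A : ℂ), A ≠ 0 ∧
      (fun z => fderiv ℝ U z - reMul (A * z ^ n)) =o[𝓝 0] (fun z : ℂ => z ^ n) := by
  obtain ⟨C, hC, ρ, hρ, hb⟩ := exists_fderiv_bound_of_vekuaTransform c
  refine ⟨ρ, hρ, fun R hR U hU hU0 hLap => ?_⟩
  have hUd : Differentiable ℝ U := hU.differentiable two_ne_zero
  set H := vekuaTransform c U with hH
  -- This is twice the Wirtinger derivative `∂H/∂z`: it is holomorphic where `H` is harmonic, and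
  -- `dH` is `reMul g`.
  set g : ℂ → ℂ := fun z => fderiv ℝ H z 1 - Complex.I * fderiv ℝ H z Complex.I with hg
  have hLapH := laplacian_vekuaTransform hU hLap
  have hgan : AnalyticOnNhd ℂ g (Metric.ball 0 R) := fun z hz =>
    HarmonicAt.analyticAt_complex_partial ⟨(contDiff_vekuaTransform c hU).contDiffAt, by
      filter_upwards [Metric.isOpen_ball.mem_nhds hz] with y hy using hLapH y hy⟩
  have hHg : ∀ z, fderiv ℝ H z = reMul (g z) := fun z => by
    ext x
    rw [fderiv_apply_eq_re_im _ x]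
    simp [reMul_apply, hg]
    ring
  have h0R : (0 : ℂ) ∈ Metric.ball 0 R := Metric.mem_ball_self hR
  by_cases hz : ∀ᶠ z in 𝓝 (0 : ℂ), g z = 0
  · left
    have hg0 := hgan.eqOn_zero_of_preconnected_of_eventuallyEq_zero
      (convex_ball _ _).isPreconnected h0R hz
    intro z hz
    rw [mem_ball_zero_iff, lt_min_iff] at hz
    -- With `g = 0` the comparison applies with `B = 0`, so the gradient of `U` vanishes on the
    -- disc.
    have h1 := hb U hU hU0 ‖z‖ hz.2.le 0 fun y hy => by
      rw [← hH, hHg, hg0 (mem_ball_zero_iff.2 (hy.trans_lt hz.1))]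
      simpa using norm_reMul_le 0
    have h2 := norm_le_of_fderiv_le hUd hU0 (D := 2 * 0) (fun y hy => (h1 y hy).1) (le_refl ‖z‖)
    simpa using h2
  · right
    obtain ⟨n, G, hG, hG0, hGe⟩ := ((hgan 0 h0R).exists_eventuallyEq_pow_smul_nonzero_iff).2 hz
    refine ⟨n, G 0, hG0, ?_⟩
    have hsplit : (fun z => fderiv ℝ U z - reMul (G 0 * z ^ n))
        = fun z => (fderiv ℝ U z - fderiv ℝ H z) + reMul (g z - G 0 * z ^ n) := by
      funext z
      rw [reMul_sub, hHg]
      abel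
    rw [hsplit]
    have hg' : ∀ᶠ z in 𝓝 (0 : ℂ), g z = z ^ n * G z := by
      filter_upwards [hGe] with z h
      simpa using h
    refine Asymptotics.IsLittleO.add ?_ ?_
    · have hbd : ∀ᶠ z in 𝓝 (0 : ℂ), ‖G z‖ ≤ ‖G 0‖ + 1 :=
        (hG.continuousAt.norm.eventually_lt_const (by linarith)).mono fun z h => h.le
      obtain ⟨δ, hδ, hδb⟩ := Metric.eventually_nhds_iff_ball.1 (hg'.and hbd)
      -- The comparison is applied on the disc of radius `‖z‖` itself, where `‖g‖ ≤ (‖G 0‖ + 1)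
      -- ‖z‖ⁿ`; it gains the factor `‖z‖²`.
      have hO : (fun z => fderiv ℝ U z - fderiv ℝ H z) =O[𝓝 0] (fun z : ℂ => z ^ 2 * z ^ n) := by
        refine Asymptotics.IsBigO.of_bound (C * (‖G 0‖ + 1)) ?_
        filter_upwards [Metric.ball_mem_nhds (0 : ℂ) hδ, Metric.ball_mem_nhds (0 : ℂ) hρ]
          with z hz hzρ
        rw [mem_ball_zero_iff] at hz hzρ
        refine ((hb U hU hU0 ‖z‖ hzρ.le ((‖G 0‖ + 1) * ‖z‖ ^ n) fun y hy => ?_) z le_rfl).2.trans ?_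
        · rw [← hH, hHg]
          obtain ⟨e1, e2⟩ := hδb y (mem_ball_zero_iff.2 (hy.trans_lt hz))
          refine (norm_reMul_le _).trans ?_
          rw [e1, norm_mul, norm_pow, mul_comm]
          gcongr
        · rw [norm_mul, norm_pow, norm_pow]
          exact le_of_eq (by ring)
      refine hO.trans_isLittleO ?_
      have : (fun z : ℂ => z ^ 2) =o[𝓝 0] (fun _ : ℂ => (1 : ℂ)) := by
        rw [Asymptotics.isLittleO_one_iff]
        exact (continuous_pow 2).tendsto' _ _ (by simp)
      simpa using this.mul_isBigO (Asymptotics.isBigO_refl (fun z : ℂ => z ^ n) (𝓝 0))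
    · have h1 : (fun z : ℂ => G z - G 0) =o[𝓝 0] (fun _ : ℂ => (1 : ℂ)) := by
        rw [Asymptotics.isLittleO_one_iff]
        exact tendsto_sub_nhds_zero_iff.2 hG.continuousAt
      have h2 : (fun z => g z - G 0 * z ^ n) =o[𝓝 0] (fun z : ℂ => z ^ n) := by
        have := h1.mul_isBigO (Asymptotics.isBigO_refl (fun z : ℂ => z ^ n) (𝓝 0))
        simp only [one_mul] at this
        refine this.congr' ?_ .rfl
        filter_upwards [hg'] with z h
        rw [h]; ring
      refine Asymptotics.IsBigO.trans_isLittleO (.of_bound 1 (.of_forall fun z => ?_)) h2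
      simpa using norm_reMul_le _

/-- `Re (A zⁿ⁺¹)/(n+1)` is a primitive of `reMul (A zⁿ)`; the mean value inequality on the disc of
radius `‖z‖` integrates the error. -/
theorem isLittleO_of_fderiv_isLittleO {U : ℂ → ℝ} (hU : Differentiable ℝ U) (hU0 : U 0 = 0) {n : ℕ}
    {A : ℂ} (h : (fun z => fderiv ℝ U z - reMul (A * z ^ n)) =o[𝓝 0] (fun z : ℂ => z ^ n)) :
    (fun z => U z - (A * z ^ (n + 1)).re / (n + 1)) =o[𝓝 0] (fun z : ℂ => z ^ (n + 1)) := by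
  set W : ℂ → ℝ := fun z => U z - (A * z ^ (n + 1)).re / (n + 1) with hW
  have hp : ∀ z : ℂ, HasFDerivAt (fun z : ℂ => (A * z ^ (n + 1)).re / ((n : ℝ) + 1))
      (reMul (A * z ^ n)) z := fun z => by
    have hn : (n : ℂ) + 1 ≠ 0 := by exact_mod_cast n.succ_ne_zero
    have h1 : HasDerivAt (fun z : ℂ => A / ((n : ℂ) + 1) * z ^ (n + 1)) (A * z ^ n) z :=
      ((hasDerivAt_pow (n + 1) z).const_mul _).congr_deriv (by
        simp only [Nat.cast_add, Nat.cast_one, Nat.add_sub_cancel]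
        field_simp)
    have h2 := Complex.reCLM.hasFDerivAt.comp z (h1.hasFDerivAt.restrictScalars ℝ)
    refine (h2.congr_fderiv ?_).congr_of_eventuallyEq (.of_forall fun z => ?_)
    · ext x
      simp [reMul_apply, mul_comm]
    · have e : A / ((n : ℂ) + 1) * z ^ (n + 1) = A * z ^ (n + 1) / (((n + 1 : ℕ) : ℝ) : ℂ) := by
        push_cast
        ring
      simp only [Function.comp_apply, Complex.reCLM_apply, e, Complex.div_ofReal_re]
      push_cast
      ring
  have hd : ∀ z, HasFDerivAt W (fderiv ℝ U z - reMul (A * z ^ n)) z := fun z =>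
    (hU z).hasFDerivAt.sub (hp z)
  rw [Asymptotics.isLittleO_iff] at h ⊢
  intro ε hε
  obtain ⟨δ, hδ, hδb⟩ := Metric.eventually_nhds_iff_ball.1 (h hε)
  filter_upwards [Metric.ball_mem_nhds (0 : ℂ) hδ] with z hz
  rw [mem_ball_zero_iff] at hz
  have := norm_le_of_fderiv_le (U := W) (r := ‖z‖) (D := ε * ‖z‖ ^ n) (z := z)
    (fun z => (hd z).differentiableAt) (by simp [hW, hU0])
    (fun y hy => by
      rw [(hd y).fderiv]
      refine (hδb y (mem_ball_zero_iff.2 (hy.trans_lt hz))).trans ?_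
      rw [norm_pow]
      gcongr) le_rfl
  rw [norm_pow]
  exact this.trans (le_of_eq (by ring))

/-- A solution vanishing near the centre of a small disc vanishes on the disc. -/
theorem helmholtz_unique_continuation_disc (c : ℝ) : ∃ ρ > 0, ∀ R > 0, ∀ U : ℂ → ℝ,
    ContDiff ℝ 2 U → (∀ᶠ z in 𝓝 0, U z = 0) →
    (∀ z ∈ Metric.ball (0 : ℂ) R, Laplacian.laplacian U z = -(4 * c) * U z) →
    ∀ z ∈ Metric.ball (0 : ℂ) (min R ρ), U z = 0 := by
  obtain ⟨ρ, hρ, h⟩ := helmholtz_local_dichotomy c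
  refine ⟨ρ, hρ, fun R hR U hU hU0 hLap => ?_⟩
  refine (h R hR U hU hU0.self_of_nhds hLap).resolve_right ?_
  rintro ⟨n, A, hA, hl⟩
  have hA' : 0 < ‖A‖ := norm_pos_iff.2 hA
  -- Where the gradient vanishes the expansion reads `‖A‖ ‖z‖ⁿ ≤ ‖A‖/2 ‖z‖ⁿ`, impossible for `z ≠
  -- 0`.
  have h1 : ∀ᶠ z in 𝓝 (0 : ℂ), z = 0 := by
    filter_upwards [Asymptotics.isLittleO_iff.1 hl (half_pos hA'), hU0.eventually_nhds] with z hz hz0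
    have e : fderiv ℝ U z = 0 := by
      rw [Filter.EventuallyEq.fderiv_eq (f₁ := U) (f := fun _ => 0) hz0]
      simp
    rw [e, zero_sub, norm_neg] at hz
    have h2 := (le_norm_reMul _).trans hz
    rw [norm_mul] at h2
    by_contra hne
    have : 0 < ‖z ^ n‖ := norm_pos_iff.2 (pow_ne_zero _ hne)
    nlinarith
  have h2 := (h1.filter_mono (nhdsWithin_le_nhds (s := {0}ᶜ))).and self_mem_nhdsWithin
  obtain ⟨z, hz1, hz2⟩ := h2.exists
  exact hz2 hz1

end LocalStructure

/-! ### Passage to the Euclidean plane and unique continuation on the domain. -/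

section UniqueContinuation

/-- The identification of the complex plane with the Euclidean plane. -/
noncomputable def complexToPlane : ℂ ≃ₗᵢ[ℝ] Plane := Complex.orthonormalBasisOneI.repr

theorem complexToPlane_apply (z : ℂ) : complexToPlane z = !₂[z.re, z.im] := by
  ext i
  fin_cases i <;> simp [complexToPlane]

theorem laplacian_comp_complexToPlane {w : Plane → ℝ} (hw : ContDiff ℝ 2 w) (x₀ : Plane) (z : ℂ) :
    Laplacian.laplacian (fun z => w (x₀ + complexToPlane z)) z
      = Laplacian.laplacian w (x₀ + complexToPlane z) := by
  rw [InnerProductSpace.laplacian_eq_iteratedFDeriv_orthonormalBasis w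
      (Complex.orthonormalBasisOneI.map complexToPlane),
    InnerProductSpace.laplacian_eq_iteratedFDeriv_orthonormalBasis _ Complex.orthonormalBasisOneI]
  refine Finset.sum_congr rfl fun i _ => ?_
  have h1 : ContDiff ℝ 2 (fun y => w (x₀ + y)) := hw.comp (contDiff_const.add contDiff_id)
  have h2 := (complexToPlane.toContinuousLinearEquiv : ℂ →L[ℝ] Plane).iteratedFDeriv_comp_right h1 z
    (i := 2) le_rfl
  have h3 := congrArg (fun L => L ![Complex.orthonormalBasisOneI i, Complex.orthonormalBasisOneI i]) h2
  refine h3.trans ?_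
  rw [ContinuousMultilinearMap.compContinuousLinearMap_apply, iteratedFDeriv_comp_add_left]
  congr 1
  ext j
  fin_cases j <;> simp

/-- The Vekua estimates are stated for functions that are `C²` on the whole plane; a bump function
supplies one that agrees with the solution near `x₀`. -/
theorem exists_local_extension {Ω : Set Plane} (hΩ : IsOpen Ω) {c : ℝ} {w : Plane → ℝ}
    (hw : ContDiffOn ℝ 2 w Ω) (hL : ∀ x ∈ Ω, Laplacian.laplacian w x = -(4 * c) * w x)
    {x₀ : Plane} {R : ℝ} (hR : 0 < R) (hB : Metric.ball x₀ (2 * R) ⊆ Ω) :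
    ∃ U : ℂ → ℝ, ContDiff ℝ 2 U ∧
      (∀ z ∈ Metric.ball (0 : ℂ) R, U z = w (x₀ + complexToPlane z)) ∧
      ∀ z ∈ Metric.ball (0 : ℂ) R, Laplacian.laplacian U z = -(4 * c) * U z := by
  let b : ContDiffBump x₀ := ⟨R, 3 / 2 * R, hR, by linarith⟩
  set W : Plane → ℝ := fun x => b x * w x with hW
  have hWd : ContDiff ℝ 2 W := by
    rw [contDiff_iff_contDiffAt]
    intro x
    by_cases hx : x ∈ Metric.ball x₀ (2 * R)
    · exact b.contDiffAt.mul (hw.contDiffAt (hΩ.mem_nhds (hB hx)))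
    · have hx' : x ∉ tsupport b := by
        rw [b.tsupport_eq]
        intro h
        have : dist x x₀ ≤ 3 / 2 * R := h
        exact hx (Metric.mem_ball.2 (by linarith))
      have h0 : (b : Plane → ℝ) =ᶠ[𝓝 x] 0 := notMem_tsupport_iff_eventuallyEq.1 hx'
      refine (contDiffAt_const (c := (0 : ℝ))).congr_of_eventuallyEq ?_
      filter_upwards [h0] with y hy
      simp [hW, hy]
  have hWe : ∀ x ∈ Metric.ball x₀ R, W x = w x := fun x hx => by
    rw [hW]
    simp only
    rw [b.one_of_mem_closedBall (Metric.ball_subset_closedBall hx), one_mul]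
  have hmem : ∀ z ∈ Metric.ball (0 : ℂ) R, x₀ + complexToPlane z ∈ Metric.ball x₀ R := fun z hz => by
    rw [Metric.mem_ball, dist_self_add_left, LinearIsometryEquiv.norm_map]
    exact mem_ball_zero_iff.1 hz
  refine ⟨fun z => W (x₀ + complexToPlane z),
    hWd.comp (contDiff_const.add complexToPlane.contDiff), fun z hz => hWe _ (hmem z hz),
    fun z hz => ?_⟩
  change _ = -(4 * c) * W (x₀ + complexToPlane z)
  rw [laplacian_comp_complexToPlane hWd, hWe _ (hmem z hz)]
  have he : W =ᶠ[𝓝 (x₀ + complexToPlane z)] w := by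
    filter_upwards [Metric.isOpen_ball.mem_nhds (hmem z hz)] with y hy using hWe y hy
  rw [(InnerProductSpace.laplacian_congr_nhds he).self_of_nhds]
  exact hL _ (hB (Metric.ball_subset_ball (by linarith) (hmem z hz)))

/-- The set of points near which `w` vanishes is open. It is relatively closed because the radius
`ρ` of the disc version depends only on `c`, not on the centre. -/
theorem helmholtz_unique_continuation {Ω : Set Plane} (hΩ : IsOpen Ω) (hc : IsPreconnected Ω) {c : ℝ}
    {w : Plane → ℝ} (hw : ContDiffOn ℝ 2 w Ω)
    (hL : ∀ x ∈ Ω, Laplacian.laplacian w x = -(4 * c) * w x) {x₀ : Plane} (hx₀ : x₀ ∈ Ω)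
    (h0 : ∀ᶠ x in 𝓝 x₀, w x = 0) : ∀ x ∈ Ω, w x = 0 := by
  obtain ⟨ρ, hρ, huc⟩ := helmholtz_unique_continuation_disc c
  have hsub : Ω ⊆ {x | ∀ᶠ y in 𝓝 x, w y = 0} := by
    refine hc.subset_of_closure_inter_subset isOpen_setOfPred_eventually_nhds ⟨x₀, hx₀, h0⟩ ?_
    rintro x ⟨hxc, hxΩ⟩
    obtain ⟨δ, hδ, hδΩ⟩ := Metric.isOpen_iff.1 hΩ x hxΩ
    -- For `y` within `R` of `x`, the disc of radius `2R` about `y` lies in `Ω`, and the disc of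
    -- radius `R ≤ ρ` on which `w` vanishes contains `x`.
    set R := min (δ / 3) ρ
    have hR : 0 < R := by positivity
    have hRδ : 3 * R ≤ δ := by linarith [min_le_left (δ / 3) ρ]
    obtain ⟨y, hy, hxy⟩ := Metric.mem_closure_iff.1 hxc R hR
    have hyΩ : Metric.ball y (2 * R) ⊆ Ω := fun q hq => hδΩ <| by
      rw [Metric.mem_ball] at hq ⊢
      have := dist_triangle q y x
      rw [dist_comm y x] at this
      linarith
    obtain ⟨U, hU, hUw, hUL⟩ := exists_local_extension hΩ hw hL hR hyΩ
    have hU0 : ∀ᶠ z in 𝓝 0, U z = 0 := by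
      have ht : Filter.Tendsto (fun z : ℂ => y + complexToPlane z) (𝓝 0) (𝓝 y) :=
        (continuous_const.add complexToPlane.continuous).tendsto' _ _ (by simp)
      filter_upwards [ht.eventually hy, Metric.ball_mem_nhds (0 : ℂ) hR] with z hz hzR
      rw [hUw z hzR, hz]
    have hz := huc R hR U hU hU0 hUL
    rw [min_eq_left (min_le_right _ _)] at hz
    have hball : ∀ q ∈ Metric.ball y R, w q = 0 := fun q hq => by
      have hm : complexToPlane.symm (q - y) ∈ Metric.ball (0 : ℂ) R := by
        rw [mem_ball_zero_iff, LinearIsometryEquiv.norm_map, ← dist_eq_norm]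
        exact hq
      have := hUw _ hm
      rw [hz _ hm] at this
      simpa using this.symm
    exact Filter.mem_of_superset (Metric.isOpen_ball.mem_nhds (Metric.mem_ball.2 hxy)) hball
  exact fun x hx => (hsub hx).self_of_nhds

end UniqueContinuation

/-! ### Leading-order analysis of the boundary conditions. -/

section RobinConditions

open Filter

/-- The complex form of the point with polar coordinates `(r, θ(r))`. -/
noncomputable def complexCurve (θ : ℝ → ℝ) (r : ℝ) : ℂ := r * Complex.exp (θ r * Complex.I)

theorem norm_complexCurve (θ : ℝ → ℝ) (r : ℝ) : ‖complexCurve θ r‖ = |r| := by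
  rw [complexCurve, norm_mul, Complex.norm_exp_ofReal_mul_I, mul_one, Complex.norm_real,
    Real.norm_eq_abs]

theorem complexToPlane_complexCurve (θ : ℝ → ℝ) (r : ℝ) :
    complexToPlane (complexCurve θ r) = polarCurve θ r := by
  rw [complexToPlane_apply, polarCurve, polarPoint, complexCurve, Complex.re_ofReal_mul,
    Complex.im_ofReal_mul, Complex.exp_ofReal_mul_I_re, Complex.exp_ofReal_mul_I_im]

/-- The complex form of the velocity of the curve. -/
noncomputable def complexVelocity (θ : ℝ → ℝ) (r : ℝ) : ℂ :=
  Complex.exp (θ r * Complex.I) * (1 + (r * deriv θ r : ℝ) * Complex.I)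

theorem complexToPlane_complexVelocity {θ : ℝ → ℝ} {r : ℝ} (hθ : DifferentiableAt ℝ θ r) :
    complexToPlane (complexVelocity θ r) = deriv (polarCurve θ) r := by
  rw [complexToPlane_apply, (hasDerivAt_polarCurve hθ).deriv]
  ext i
  fin_cases i
  · simp [complexVelocity, Complex.exp_ofReal_mul_I_re, Complex.exp_ofReal_mul_I_im]
    ring
  · simp [complexVelocity, Complex.exp_ofReal_mul_I_re, Complex.exp_ofReal_mul_I_im]
    ring

theorem rotateRight_complexToPlane (v : ℂ) :
    rotateRight (complexToPlane v) = complexToPlane (Complex.I * v) := by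
  ext i
  fin_cases i <;> simp [rotateRight, complexToPlane_apply]

section Asymptotics

variable {U : ℂ → ℝ} {n : ℕ} {A : ℂ} {θ : ℝ → ℝ} {θ₀ : ℝ}

theorem tendsto_complexCurve (θ : ℝ → ℝ) : Tendsto (complexCurve θ) (𝓝[>] 0) (𝓝 0) := by
  rw [tendsto_zero_iff_norm_tendsto_zero]
  simp only [norm_complexCurve]
  exact (continuous_abs.tendsto' 0 0 abs_zero).mono_left nhdsWithin_le_nhds

theorem tendsto_exp_mul_I (hθ : Tendsto θ (𝓝[>] 0) (𝓝 θ₀)) :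
    Tendsto (fun r => Complex.exp (θ r * Complex.I)) (𝓝[>] 0) (𝓝 (Complex.exp (θ₀ * Complex.I))) :=
  ((Complex.continuous_exp.comp (Complex.continuous_ofReal.mul continuous_const)).tendsto θ₀).comp hθ

/-- On the curve `|z| = |r|`, so the expansion can be divided by `rⁿ`. The direction may vary with
`r`, since evaluation of a functional is jointly continuous. Limits from the right suffice for the
phase condition. -/
theorem tendsto_fderiv_complexCurve
    (hl : (fun z => fderiv ℝ U z - reMul (A * z ^ n)) =o[𝓝 0] (fun z : ℂ => z ^ n))
    (hθ : Tendsto θ (𝓝[>] 0) (𝓝 θ₀)) {a : ℝ → ℂ} {a₀ : ℂ} (ha : Tendsto a (𝓝[>] 0) (𝓝 a₀)) :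
    Tendsto (fun r : ℝ => (r ^ n)⁻¹ * fderiv ℝ U (complexCurve θ r) (a r)) (𝓝[>] 0)
      (𝓝 (A * Complex.exp (θ₀ * Complex.I) ^ n * a₀).re) := by
  have h1 : (fun r => fderiv ℝ U (complexCurve θ r) - reMul (A * complexCurve θ r ^ n))
      =o[𝓝[>] 0] (fun r : ℝ => r ^ n) := by
    refine (hl.comp_tendsto (tendsto_complexCurve θ)).trans_isBigO (.of_bound 1 ?_)
    refine .of_forall fun r => ?_
    simp [norm_complexCurve]
  have h2 : Tendsto (fun r : ℝ => (r ^ n)⁻¹ •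
      (fderiv ℝ U (complexCurve θ r) - reMul (A * complexCurve θ r ^ n))) (𝓝[>] 0) (𝓝 0) :=
    h1.tendsto_inv_smul_nhds_zero
  have h3 : Tendsto (fun r : ℝ => (r ^ n)⁻¹ *
      (fderiv ℝ U (complexCurve θ r) - reMul (A * complexCurve θ r ^ n)) (a r)) (𝓝[>] 0) (𝓝 0) := by
    simpa [Function.comp_def] using
      ((isBoundedBilinearMap_apply (𝕜 := ℝ) (E := ℂ) (F := ℝ)).continuous.tendsto
        ((0 : ℂ →L[ℝ] ℝ), a₀)).comp (h2.prodMk_nhds ha)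
  have h4 : Tendsto (fun r : ℝ => (A * Complex.exp (θ r * Complex.I) ^ n * a r).re) (𝓝[>] 0)
      (𝓝 (A * Complex.exp (θ₀ * Complex.I) ^ n * a₀).re) :=
    (Complex.continuous_re.tendsto _).comp
      ((((tendsto_exp_mul_I hθ).pow n).const_mul A).mul ha)
  have h5 := h3.add h4
  rw [zero_add] at h5
  refine h5.congr' ?_
  filter_upwards [self_mem_nhdsWithin] with r hr
  have hr' : (r : ℝ) ^ n ≠ 0 := pow_ne_zero _ (ne_of_gt hr)
  have e : A * complexCurve θ r ^ n * a r
      = ((r ^ n : ℝ) : ℂ) * (A * Complex.exp (θ r * Complex.I) ^ n * a r) := by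
    rw [complexCurve]; push_cast; ring
  rw [sub_apply, reMul_apply, e, Complex.re_ofReal_mul]
  field_simp
  ring

theorem tendsto_complexCurve_value
    (hl : (fun z => U z - (A * z ^ (n + 1)).re / (n + 1)) =o[𝓝 0] (fun z : ℂ => z ^ (n + 1)))
    (hθ : Tendsto θ (𝓝[>] 0) (𝓝 θ₀)) :
    Tendsto (fun r : ℝ => (r ^ (n + 1))⁻¹ * U (complexCurve θ r)) (𝓝[>] 0)
      (𝓝 ((A * Complex.exp (θ₀ * Complex.I) ^ (n + 1)).re / (n + 1))) := by
  have h1 : (fun r => U (complexCurve θ r) - (A * complexCurve θ r ^ (n + 1)).re / (n + 1))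
      =o[𝓝[>] 0] (fun r : ℝ => r ^ (n + 1)) := by
    refine (hl.comp_tendsto (tendsto_complexCurve θ)).trans_isBigO (.of_bound 1 ?_)
    refine .of_forall fun r => ?_
    simp [norm_complexCurve]
  have h2 := h1.tendsto_inv_smul_nhds_zero
  have h4 : Tendsto (fun r : ℝ => (A * Complex.exp (θ r * Complex.I) ^ (n + 1)).re / (n + 1))
      (𝓝[>] 0) (𝓝 ((A * Complex.exp (θ₀ * Complex.I) ^ (n + 1)).re / (n + 1))) :=
    ((Complex.continuous_re.tendsto _).comp
      (((tendsto_exp_mul_I hθ).pow (n + 1)).const_mul A)).div_const _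
  have h5 := h2.add h4
  rw [zero_add] at h5
  refine h5.congr' ?_
  filter_upwards [self_mem_nhdsWithin] with r hr
  have hr' : (r : ℝ) ^ (n + 1) ≠ 0 := pow_ne_zero _ (ne_of_gt hr)
  have e : A * complexCurve θ r ^ (n + 1)
      = ((r ^ (n + 1) : ℝ) : ℂ) * (A * Complex.exp (θ r * Complex.I) ^ (n + 1)) := by
    rw [complexCurve]; push_cast; ring
  rw [e, Complex.re_ofReal_mul, smul_eq_mul]
  field_simp
  ring

/-- The leading order part of the Robin condition at the origin. -/
theorem re_eq_zero_of_robin (hU : Differentiable ℝ U) (hU0 : U 0 = 0)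
    (hl : (fun z => fderiv ℝ U z - reMul (A * z ^ n)) =o[𝓝 0] (fun z : ℂ => z ^ n))
    {α β β' : ℝ → ℝ} (hα : ContinuousAt α 0) (hβ : ContinuousAt β 0) (hβ' : ContinuousAt β' 0)
    (hθ : ContinuousAt θ 0) (hθ' : ContinuousAt (deriv θ) 0) (hnd : NonDegenerate α β β')
    (hR : ∀ᶠ r in 𝓝 (0 : ℝ), α r * U (complexCurve θ r) + fderiv ℝ U (complexCurve θ r)
      ((β r + Complex.I * β' r) * complexVelocity θ r) = 0) :
    (A * Complex.exp (((n + 1 : ℕ) * θ 0 + phase β β' : ℝ) * Complex.I)).re = 0 := by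
  have hle : 𝓝[>] (0 : ℝ) ≤ 𝓝 0 := nhdsWithin_le_nhds
  have hθt : Tendsto θ (𝓝[>] 0) (𝓝 (θ 0)) := hθ.tendsto.mono_left hle
  have hvel : Tendsto (fun r => complexVelocity θ r) (𝓝[>] 0) (𝓝 (Complex.exp (θ 0 * Complex.I))) := by
    have h1 : Tendsto (fun r : ℝ => r * deriv θ r) (𝓝[>] 0) (𝓝 0) := by
      simpa [Pi.mul_def] using (continuousAt_id.mul hθ').tendsto.mono_left hle
    have h2 := (tendsto_exp_mul_I hθt).mul
      (((((Complex.continuous_ofReal.tendsto _).comp h1).mul_const Complex.I).const_add 1))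
    simpa [complexVelocity, Function.comp_def] using h2
  have hval := tendsto_complexCurve_value (isLittleO_of_fderiv_isLittleO hU hU0 hl) hθt
  by_cases hdeg : β 0 = 0 ∧ β' 0 = 0
  · obtain ⟨hα0, hβo, hβ'o⟩ := hnd hdeg
    -- Degenerate case: divide by `rⁿ⁺¹`. As `β` and `β'` are `o(r)`, the gradient term disappears
    -- and `α(0) ≠ 0` isolates the leading value of `U`.
    have h1 : Tendsto (fun r : ℝ => ((β r / r : ℝ) + Complex.I * (β' r / r : ℝ)) * complexVelocity θ r)
        (𝓝[>] 0) (𝓝 0) := by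
      have h2 := (Complex.continuous_ofReal.tendsto _).comp (hβo.mono hle).tendsto_div_nhds_zero
      have h3 := (Complex.continuous_ofReal.tendsto _).comp (hβ'o.mono hle).tendsto_div_nhds_zero
      simpa using (h2.add (h3.const_mul Complex.I)).mul hvel
    have h2 := ((hα.tendsto.mono_left hle).mul hval).add (tendsto_fderiv_complexCurve hl hθt h1)
    have h3 := tendsto_nhds_unique_of_eventuallyEq h2 tendsto_const_nhds (b := (0 : ℝ)) <| by
      filter_upwards [self_mem_nhdsWithin, hle hR] with r hr hr2
      have hr0 : r ≠ 0 := ne_of_gt hr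
      have e : ((β r / r : ℝ) + Complex.I * (β' r / r : ℝ)) * complexVelocity θ r
          = r⁻¹ • ((β r + Complex.I * β' r) * complexVelocity θ r) := by
        rw [Complex.real_smul]; push_cast; ring
      rw [e, map_smul, smul_eq_mul, pow_succ]
      calc _ = (r ^ n)⁻¹ * r⁻¹ * (α r * U (complexCurve θ r) + fderiv ℝ U (complexCurve θ r)
            ((β r + Complex.I * β' r) * complexVelocity θ r)) := by
            rw [mul_inv]; ring
        _ = 0 := by rw [hr2, mul_zero]
    have hn : (n : ℝ) + 1 ≠ 0 := by positivity
    simp only [mul_zero, Complex.zero_re, add_zero, mul_eq_zero, hα0, false_or, div_eq_zero_iff, hn,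
      or_false] at h3
    refine Eq.trans ?_ h3
    rw [phase, if_pos hdeg, ← Complex.exp_nat_mul]
    congr 3
    push_cast
    ring
  · have h1 : Tendsto (fun r : ℝ => (β r + Complex.I * β' r) * complexVelocity θ r) (𝓝[>] 0)
        (𝓝 ((β 0 + Complex.I * β' 0) * Complex.exp (θ 0 * Complex.I))) := by
      have h2 := (Complex.continuous_ofReal.tendsto _).comp (hβ.tendsto.mono_left hle)
      have h3 := (Complex.continuous_ofReal.tendsto _).comp (hβ'.tendsto.mono_left hle)
      exact (h2.add (h3.const_mul Complex.I)).mul hvel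
    -- Non-degenerate case: divide by `rⁿ`. The value term keeps a spare factor `r` and disappears,
    -- leaving the gradient term.
    have h2 := (((tendsto_id.mono_left hle).mul (hα.tendsto.mono_left hle)).mul hval).add
      (tendsto_fderiv_complexCurve hl hθt h1)
    have h3 := tendsto_nhds_unique_of_eventuallyEq h2 tendsto_const_nhds (b := (0 : ℝ)) <| by
      filter_upwards [self_mem_nhdsWithin, hle hR] with r hr hr2
      have hr0 : r ≠ 0 := ne_of_gt hr
      calc _ = (r ^ n)⁻¹ * (α r * U (complexCurve θ r) + fderiv ℝ U (complexCurve θ r)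
            ((β r + Complex.I * β' r) * complexVelocity θ r)) := by
            rw [pow_succ, mul_inv]
            simp only [id]
            field_simp
        _ = 0 := by rw [hr2, mul_zero]
    set b : ℂ := β 0 + Complex.I * β' 0 with hb
    have hb0 : ‖b‖ ≠ 0 := by
      rw [norm_ne_zero_iff]
      intro h
      refine hdeg ⟨?_, ?_⟩
      · simpa [hb] using congrArg Complex.re h
      · simpa [hb] using congrArg Complex.im h
    have e : A * Complex.exp (θ 0 * Complex.I) ^ n * (b * Complex.exp (θ 0 * Complex.I))
        = (‖b‖ : ℂ) * (A * Complex.exp (((n + 1 : ℕ) * θ 0 + phase β β' : ℝ) * Complex.I)) := by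
      rw [phase, if_neg hdeg, ← hb]
      have e1 : (((n + 1 : ℕ) * θ 0 + b.arg : ℝ) : ℂ) * Complex.I
          = (n : ℕ) * (θ 0 * Complex.I) + θ 0 * Complex.I + b.arg * Complex.I := by
        push_cast; ring
      rw [e1, Complex.exp_add, Complex.exp_add, Complex.exp_nat_mul]
      conv_lhs => rw [← Complex.norm_mul_exp_arg_mul_I b]
      ring
    rw [e, Complex.re_ofReal_mul] at h3
    simpa [hb0] using h3

end Asymptotics

/-- The hypotheses form a homogeneous linear system in `(Re A, Im A)` whose determinant is `± sin (x
- y)`; a nonzero solution forces it to vanish. -/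
theorem exists_int_mul_pi_of_re_eq_zero {A : ℂ} (hA : A ≠ 0) {x y : ℝ}
    (hx : (A * Complex.exp (x * Complex.I)).re = 0) (hy : (A * Complex.exp (y * Complex.I)).re = 0) :
    ∃ m : ℤ, (m : ℝ) * Real.pi = x - y := by
  rw [← Real.sin_eq_zero_iff, Real.sin_sub]
  rw [Complex.mul_re, Complex.exp_ofReal_mul_I_re, Complex.exp_ofReal_mul_I_im] at hx hy
  have h : A.re * (Real.sin x * Real.cos y - Real.cos x * Real.sin y) = 0 := by
    linear_combination Real.sin x * hy - Real.sin y * hx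
  have h' : A.im * (Real.sin x * Real.cos y - Real.cos x * Real.sin y) = 0 := by
    linear_combination Real.cos x * hy - Real.cos y * hx
  by_contra hne
  exact hA (Complex.ext ((mul_eq_zero.1 h).resolve_right hne) ((mul_eq_zero.1 h').resolve_right hne))

theorem clm_ofReal_mul (L : ℂ →L[ℝ] ℝ) (a : ℝ) (z : ℂ) : L ((a : ℂ) * z) = a * L z := by
  rw [← Complex.real_smul, map_smul, smul_eq_mul]

/-- The Robin condition for a real component of `u`, in complex coordinates. -/
theorem robin_component {r₀ R : ℝ} {Ω : Set Plane} (hΩ : IsOpen Ω) {u : Plane → ℂ}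
    (hu : ContDiffOn ℝ 2 u Ω) {α β β' θ : ℝ → ℝ} (hR : 0 < R) (hRr : R ≤ r₀)
    (hB : Metric.ball 0 R ⊆ Ω)
    (hθ : ∀ r ∈ Set.Ioo (-r₀) r₀, DifferentiableAt ℝ θ r)
    (hrob : RobinCondition r₀ α β β' θ u) (L : ℂ →L[ℝ] ℝ) {U : ℂ → ℝ}
    (hUe : ∀ z ∈ Metric.ball (0 : ℂ) R, U z = L (u (complexToPlane z))) :
    ∀ᶠ r in 𝓝 (0 : ℝ), α r * U (complexCurve θ r) + fderiv ℝ U (complexCurve θ r)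
      ((β r + Complex.I * β' r) * complexVelocity θ r) = 0 := by
  filter_upwards [Ioo_mem_nhds (neg_lt_zero.2 hR) hR] with r hr
  have hr0 : r ∈ Set.Ioo (-r₀) r₀ := ⟨by linarith [hr.1], by linarith [hr.2]⟩
  have hmem : complexCurve θ r ∈ Metric.ball (0 : ℂ) R := by
    rw [mem_ball_zero_iff, norm_complexCurve]
    exact abs_lt.2 hr
  have hmem' : complexToPlane (complexCurve θ r) ∈ Ω := hB <| by
    rw [mem_ball_zero_iff, LinearIsometryEquiv.norm_map]
    exact mem_ball_zero_iff.1 hmem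
  have hd : HasFDerivAt U (L.comp ((fderiv ℝ u (polarCurve θ r)).comp
      (complexToPlane.toContinuousLinearEquiv : ℂ →L[ℝ] Plane))) (complexCurve θ r) := by
    have h1 := ((hu.contDiffAt (hΩ.mem_nhds hmem')).differentiableAt two_ne_zero).hasFDerivAt
    have h2 := L.hasFDerivAt.comp (complexCurve θ r)
      (h1.comp (complexCurve θ r) complexToPlane.toContinuousLinearEquiv.hasFDerivAt)
    rw [complexToPlane_complexCurve] at h2
    refine h2.congr_of_eventuallyEq ?_
    filter_upwards [Metric.isOpen_ball.mem_nhds hmem] with z hz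
    exact hUe z hz
  have h := congrArg L (hrob r hr0)
  rw [tangentialDeriv, normalDeriv, ← complexToPlane_complexVelocity (hθ r hr0),
    rotateRight_complexToPlane, map_add, map_add, clm_ofReal_mul, clm_ofReal_mul, clm_ofReal_mul,
    map_zero] at h
  have e : (β r + Complex.I * β' r) * complexVelocity θ r
      = β r • complexVelocity θ r + β' r • (Complex.I * complexVelocity θ r) := by
    rw [Complex.real_smul, Complex.real_smul]; ring
  rw [hUe _ hmem, complexToPlane_complexCurve, e, map_add, map_smul, map_smul, hd.fderiv]
  simpa [add_assoc] using h

theorem component_eq_zero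
    (Ω : Set Plane) (hΩ_open : IsOpen Ω) (hΩ_conn : IsConnected Ω)
    (r₀ : ℝ) (hr₀ : 0 < r₀) (hball : Metric.ball (0 : Plane) r₀ ⊆ Ω)
    (k : ℝ) (α β β' θ : Fin 2 → ℝ → ℝ)
    (hα : ∀ j, ContDiffOn ℝ 1 (α j) (Set.Ioo (-r₀) r₀))
    (hβ : ∀ j, ContDiffOn ℝ 1 (β j) (Set.Ioo (-r₀) r₀))
    (hβ' : ∀ j, ContDiffOn ℝ 1 (β' j) (Set.Ioo (-r₀) r₀))
    (hθ : ∀ j, ContDiffOn ℝ 1 (θ j) (Set.Ioo (-r₀) r₀))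
    (hnondeg : ∀ j, NonDegenerate (α j) (β j) (β' j))
    (hgeneric : ∀ n m : ℤ, n ≠ 0 →
      phase (β 0) (β' 0) - phase (β 1) (β' 1) ≠ (n : ℝ) * (θ 0 0 - θ 1 0) + (m : ℝ) * Real.pi)
    (u : Plane → ℂ) (hu : IsHelmholtzSolution Ω k u)
    (hrobin : ∀ j, RobinCondition r₀ (α j) (β j) (β' j) (θ j) u)
    (hu0 : u 0 = 0) (L : ℂ →L[ℝ] ℝ) : ∀ x ∈ Ω, L (u x) = 0 := by
  have hw : ContDiffOn ℝ 2 (fun x => L (u x)) Ω := L.contDiff.comp_contDiffOn hu.contDiffOn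
  have hL : ∀ x ∈ Ω, Laplacian.laplacian (fun x => L (u x)) x = -(4 * (k ^ 2 / 4)) * L (u x) := by
    intro x hx
    have h1 := (hu.contDiffOn.contDiffAt (hΩ_open.mem_nhds hx)).laplacian_CLM_comp_left (l := L)
    have h2 := congrArg L (hu.equation x hx)
    rw [map_add, ← Complex.ofReal_pow, clm_ofReal_mul, map_zero] at h2
    refine h1.trans ?_
    simp only [Function.comp_apply]
    linear_combination h2
  have h0Ω : (0 : Plane) ∈ Ω := hball (Metric.mem_ball_self hr₀)
  -- Half the radius, because the extension requires the disc of radius `2R` inside the domain.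
  set R := r₀ / 2
  have hR : 0 < R := by positivity
  have hRr : R ≤ r₀ := by simp only [R]; linarith
  obtain ⟨U, hU, hUe, hUL⟩ := exists_local_extension hΩ_open hw hL (x₀ := 0) hR
    (by rwa [show 2 * R = r₀ by simp only [R]; ring])
  simp only [zero_add] at hUe
  have hU0 : U 0 = 0 := by
    rw [hUe 0 (Metric.mem_ball_self hR), map_zero, hu0, map_zero]
  have hUd : Differentiable ℝ U := hU.differentiable two_ne_zero
  obtain ⟨ρ, hρ, hdich⟩ := helmholtz_local_dichotomy (k ^ 2 / 4)
  rcases hdich R hR U hU hU0 hUL with hzero | ⟨n, A, hA, hl⟩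
  · refine helmholtz_unique_continuation hΩ_open hΩ_conn.isPreconnected hw hL h0Ω ?_
    filter_upwards [Metric.ball_mem_nhds (0 : Plane) (lt_min hR hρ)] with x hx
    have hx' : complexToPlane.symm x ∈ Metric.ball (0 : ℂ) (min R ρ) := by
      rw [mem_ball_zero_iff, LinearIsometryEquiv.norm_map]
      exact mem_ball_zero_iff.1 hx
    have h1 := hUe _ (Metric.ball_subset_ball (min_le_left _ _) hx')
    rw [hzero _ hx', LinearIsometryEquiv.apply_symm_apply] at h1
    exact h1.symm
  · exfalso
    have hI : Set.Ioo (-r₀) r₀ ∈ 𝓝 (0 : ℝ) := Ioo_mem_nhds (neg_lt_zero.2 hr₀) hr₀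
    have key : ∀ j, (A * Complex.exp
        (((n + 1 : ℕ) * θ j 0 + phase (β j) (β' j) : ℝ) * Complex.I)).re = 0 := fun j =>
      re_eq_zero_of_robin hUd hU0 hl ((hα j).continuousOn.continuousAt hI)
        ((hβ j).continuousOn.continuousAt hI) ((hβ' j).continuousOn.continuousAt hI)
        ((hθ j).continuousOn.continuousAt hI)
        (((hθ j).continuousOn_deriv_of_isOpen isOpen_Ioo le_rfl).continuousAt hI) (hnondeg j)
        (robin_component hΩ_open hu.contDiffOn hR hRr
          ((Metric.ball_subset_ball hRr).trans hball)
          (fun r hr => ((hθ j).contDiffAt (isOpen_Ioo.mem_nhds hr)).differentiableAt one_ne_zero)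
          (hrobin j) L hUe)
    obtain ⟨m, hm⟩ := exists_int_mul_pi_of_re_eq_zero hA (key 0) (key 1)
    -- Solving for the difference of the `phase` terms turns `n + 1` into `-(n + 1)`, nonzero even
    -- when `n = 0`.
    refine hgeneric (-(n + 1 : ℕ)) m (by omega) ?_
    push_cast at hm ⊢
    linear_combination -hm

end RobinConditions

end RobinHelmholtz

theorem mainTheorem3
    (Ω : Set RobinHelmholtz.Plane) (hΩ_open : IsOpen Ω) (hΩ_conn : IsConnected Ω)
    (r₀ : ℝ) (hr₀ : 0 < r₀) (hball : Metric.ball (0 : RobinHelmholtz.Plane) r₀ ⊆ Ω)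
    (k : ℝ)
    (α β β' θ : Fin 2 → ℝ → ℝ)
    (hα : ∀ j, ContDiffOn ℝ 1 (α j) (Set.Ioo (-r₀) r₀))
    (hβ : ∀ j, ContDiffOn ℝ 1 (β j) (Set.Ioo (-r₀) r₀))
    (hβ' : ∀ j, ContDiffOn ℝ 1 (β' j) (Set.Ioo (-r₀) r₀))
    (hθ : ∀ j, ContDiffOn ℝ 1 (θ j) (Set.Ioo (-r₀) r₀))
    (hnondeg : ∀ j, RobinHelmholtz.NonDegenerate (α j) (β j) (β' j))
    (hgeneric : ∀ n m : ℤ, n ≠ 0 →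
      RobinHelmholtz.phase (β 0) (β' 0) - RobinHelmholtz.phase (β 1) (β' 1)
        ≠ (n : ℝ) * (θ 0 0 - θ 1 0) + (m : ℝ) * Real.pi)
    (u : RobinHelmholtz.Plane → ℂ)
    (hu : RobinHelmholtz.IsHelmholtzSolution Ω k u)
    (hrobin : ∀ j, RobinHelmholtz.RobinCondition r₀ (α j) (β j) (β' j) (θ j) u)
    (hu0 : u 0 = 0) :
    ∀ x ∈ Ω, u x = 0 := by
  intro x hx
  have h := RobinHelmholtz.component_eq_zero Ω hΩ_open hΩ_conn r₀ hr₀ hball k α β β' θ hα hβ hβ' hθ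
    hnondeg hgeneric u hu hrobin hu0
  exact Complex.ext (by simpa using h Complex.reCLM x hx) (by simpa using h Complex.imCLM x hx)
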